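/- **Theorem.** Let $(\mathsf Z,d)$ be a complete separable metric space with its Borel $\sigma$-field and let $Q$ be a Markov kernel on $\mathsf Z$ which has a unique invariant probability measure $\pi$ and is uniformly geometrically ergodic with mixing time $\tau$: there is an integer $\tau\ge 1$ such that, for all $n\in\mathbb N$ and $z\in\mathsf Z$, $$\tfrac12\,\|Q^n(z,\cdot)-\pi\|_{\mathrm{TV}}\le (1/4)^{\lfloor n/\tau\rfloor},$$ where $\|\mu-\nu\|_{\mathrm{TV}}$ is the total mass of the total variation measure $|\mu-\nu|$. For a probability measure $\xi$ on $\mathsf Z$ let $\mathrm E_\xi$ be the expectation for the Markov chain $(Z_k)_{k\ge0}$ with kernel $Q$ and initial distribution $\xi$. Let $f:\mathsf Z\to\mathbb R$ be measurable with $\|f\|_\infty=\sup_z|f(z)|\le 1$, and put $\bar f=f-\pi(f)$, $\bar S_n=\sum_{i=0}^{n-1}\bar f(Z_i)$ and $$\sigma_\pi^2(f)=\pi(\bar f^2)+2\sum_{\ell=1}^\infty\pi(\bar f\,Q^\ell\bar f).$$ Then this series converges absolutely, $\sigma_\pi^2(f)\ge0$, and for every real $p\ge2$ and every $n\in\mathbb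 N$ $$\mathrm E_\pi^{1/p}\big[|\bar S_n|^p\big]\le C_{\mathrm{Rm},1}\sqrt2\,p^{1/2}n^{1/2}\sigma_\pi(f)+D_1\,n^{1/4}\tau^{3/4}\,p\log_2(2p)+D_2\,\tau\,p\log_2(2p),$$ where $C_{\mathrm{Rm},1}=60e$, $C_{\mathrm{Rm},2}=60$, $D_1=\frac{16}{3}\big(\frac{19}{3}\big)^{1/2}C_{\mathrm{Rm},1}$ and $D_2=\frac{64}{3}\big(C_{\mathrm{Rm},2}^{1/2}C_{\mathrm{Rm},1}^2+C_{\mathrm{Rm},2}\big)$. Moreover, for every probability measure $\xi$ on $\mathsf Z$, $$\mathrm E_\xi^{1/p}\big[|\bar S_n|^p\big]\le \mathrm E_\pi^{1/p}\big[|\bar S_n|^p\big]+2D_2\,\tau\,p\log_2(2p).$$ -/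

import Mathlib

open MeasureTheory ProbabilityTheory

noncomputable section

namespace MarkovRosenthal

variable {Z : Type*} [MeasurableSpace Z]

instance isMarkovKernel_pow (Q : Kernel Z Z) [IsMarkovKernel Q] (n : ℕ) :
    IsMarkovKernel (Q ^ n) := by
  induction n with
  | zero =>
    rw [pow_zero]
    exact inferInstanceAs (IsMarkovKernel Kernel.id)
  | succ n ih =>
    rw [pow_succ]
    exact inferInstanceAs (IsMarkovKernel ((Q ^ n) ∘ₖ Q))

/-- The total variation norm `‖μ - ν‖_TV` of the signed measure `μ - ν`, i.e. the total mass of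
its total variation `|μ - ν|` (it ranges over `[0, 2]` for probability measures). -/
def tvNorm (μ ν : Measure Z) [IsFiniteMeasure μ] [IsFiniteMeasure ν] : ℝ :=
  ((μ.toSignedMeasure - ν.toSignedMeasure).totalVariation Set.univ).toReal

/-- `π` is the unique invariant probability measure of the Markov kernel `Q`, and `Q` is uniformly
geometrically ergodic with mixing time `τ ≥ 1`:
`(1/2) ‖Q^n(z, ·) - π‖_TV ≤ (1/4) ^ ⌊n / τ⌋` for all `n` and `z`.
The quotient `n / τ` is the floor division of natural numbers. -/
structure IsUniformlyGeometricallyErgodic (Q : Kernel Z Z) [IsMarkovKernel Q]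
    (π : Measure Z) [IsProbabilityMeasure π] (τ : ℕ) : Prop where
  invariant : Kernel.Invariant Q π
  unique : ∀ ν : Measure Z, IsProbabilityMeasure ν → Kernel.Invariant Q ν → ν = π
  mixingTime_pos : 0 < τ
  tv_le : ∀ (n : ℕ) (z : Z), (1 / 2 : ℝ) * tvNorm ((Q ^ n) z) π ≤ (1 / 4 : ℝ) ^ (n / τ)

/-- The law `P_ξ` on `Z^ℕ` of the Markov chain with kernel `Q` and initial distribution `ξ`;
the chain is the coordinate process `ω ↦ ω i`. -/
def chainLaw (Q : Kernel Z Z) [IsMarkovKernel Q] (ξ : Measure Z) : Measure (ℕ → Z) :=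
  Kernel.trajMeasure (X := fun _ => Z) ξ
    (fun n => Q.comap (fun h : (i : Finset.Iic n) → Z => h ⟨n, Finset.mem_Iic.2 le_rfl⟩)
      (measurable_pi_apply _))

/-- The centered function `f - π(f)`. -/
def centered (π : Measure Z) (f : Z → ℝ) (z : Z) : ℝ :=
  f z - ∫ x, f x ∂π

/-- The centered sum `∑_{i=0}^{n-1} (f(Z_i) - π(f))` along a trajectory `ω`. -/
def centeredSum (π : Measure Z) (f : Z → ℝ) (n : ℕ) (ω : ℕ → Z) : ℝ :=
  ∑ i ∈ Finset.range n, centered π f (ω i)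

/-- `E_ξ^{1/p}[|∑_{i=0}^{n-1} (f(Z_i) - π(f))|^p]`. -/
def momentNorm (Q : Kernel Z Z) [IsMarkovKernel Q] (ξ π : Measure Z) (f : Z → ℝ)
    (n : ℕ) (p : ℝ) : ℝ :=
  (∫ ω, |centeredSum π f n ω| ^ p ∂(chainLaw Q ξ)) ^ (1 / p)

/-- The autocovariance `π(g Q^ℓ g)` of the centered function `g = f - π(f)`. -/
def autocov (Q : Kernel Z Z) (π : Measure Z) (f : Z → ℝ) (l : ℕ) : ℝ :=
  ∫ z, centered π f z * (∫ x, centered π f x ∂((Q ^ l) z)) ∂π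

/-- The asymptotic variance `σ_π²(f) = π(g²) + 2 ∑_{ℓ ≥ 1} π(g Q^ℓ g)`, where `g = f - π(f)`. -/
def asymptoticVariance (Q : Kernel Z Z) (π : Measure Z) (f : Z → ℝ) : ℝ :=
  (∫ z, centered π f z ^ 2 ∂π) + 2 * ∑' l : ℕ, autocov Q π f (l + 1)

/-- `σ_π(f)`, the square root of the asymptotic variance. -/
def asymptoticStd (Q : Kernel Z Z) (π : Measure Z) (f : Z → ℝ) : ℝ :=
  Real.sqrt (asymptoticVariance Q π f)

/-- The constant `C_{Rm,1} = 60 e`. -/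
def CRm1 : ℝ := 60 * Real.exp 1

/-- The constant `C_{Rm,2} = 60`. -/
def CRm2 : ℝ := 60

/-- The constant `D₁ = (16/3) (19/3)^{1/2} C_{Rm,1}`. -/
def D1 : ℝ := 16 / 3 * Real.sqrt (19 / 3) * CRm1

/-- The constant `D₂ = (64/3) (C_{Rm,2}^{1/2} C_{Rm,1}² + C_{Rm,2})`. -/
def D2 : ℝ := 64 / 3 * (Real.sqrt CRm2 * CRm1 ^ 2 + CRm2)

end MarkovRosenthal

end

/-!
The function `g = f - π(f)` solves the Poisson equation `u - Q u = g`, so the sum `∑ g(Z_i)` is a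
martingale up to a bounded boundary term. The exponential moments of this martingale are controlled
by its quadratic variation, whose conditional expectation over a block of `τ` steps is a function of
the current state; a second Poisson equation, for the kernel `Q ^ τ`, replaces it by its stationary
mean `τ σ_π²(f)` up to an error of fourth order. This gives
`E exp(θ ∑ g(Z_i)) ≤ exp(2 n θ² σ_π²(f) + O(n τ³ θ⁴) + 1)` for `|θ| τ ≤ 1 / 40` and every initial
law, and `x ^ p ≤ (p / (e θ)) ^ p * exp(θ x)` with `θ` the reciprocal of
`(n / p)^{1/2} σ_π(f) + 32 n^{1/4} τ^{3/4} + 40 τ` turns it into the moment bound.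

Two initial laws are compared by matching their common parts every `2 τ` steps: the mass left
unmatched shrinks each time by the factor `1 / 4`, while each round changes the sum by at most
`4 τ`, so the discrepancy has a geometric tail and its `p`-th moment norm is of order `τ p`.
-/

namespace MarkovRosenthal

/-- Bounded measurable real functions, the class of functions on which the kernels act. The
`σ`-algebra is an explicit argument because adapted processes are measurable with respect to the
`σ`-algebras of the past. -/
structure BoundedMeasurable {X : Type*} (m : MeasurableSpace X) (φ : X → ℝ) : Prop where
  measurable : Measurable[m] φ
  bounded : ∃ C, ∀ x, |φ x| ≤ C

namespace BoundedMeasurable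

variable {X Y : Type*} {m : MeasurableSpace X} {φ ψ : X → ℝ}

lemma of_abs_le {C : ℝ} (h : Measurable[m] φ) (hC : ∀ x, |φ x| ≤ C) : BoundedMeasurable m φ :=
  ⟨h, C, hC⟩

lemma mono {m' : MeasurableSpace X} (hm : m ≤ m') (h : BoundedMeasurable m φ) :
    BoundedMeasurable m' φ :=
  ⟨h.measurable.mono hm le_rfl, h.bounded⟩

lemma const (c : ℝ) : BoundedMeasurable m (fun _ => c) :=
  ⟨measurable_const, |c|, fun _ => le_rfl⟩

lemma add (h : BoundedMeasurable m φ) (h' : BoundedMeasurable m ψ) :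
    BoundedMeasurable m (fun x => φ x + ψ x) := by
  obtain ⟨hm, C, hC⟩ := h
  obtain ⟨hm', C', hC'⟩ := h'
  exact ⟨hm.add hm', C + C', fun x => (abs_add_le _ _).trans (add_le_add (hC x) (hC' x))⟩

lemma mul (h : BoundedMeasurable m φ) (h' : BoundedMeasurable m ψ) :
    BoundedMeasurable m (fun x => φ x * ψ x) := by
  obtain ⟨hm, C, hC⟩ := h
  obtain ⟨hm', C', hC'⟩ := h'
  refine ⟨hm.mul hm', C * C', fun x => ?_⟩
  rw [abs_mul]
  exact mul_le_mul (hC x) (hC' x) (abs_nonneg _) ((abs_nonneg _).trans (hC x))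

lemma const_mul (c : ℝ) (h : BoundedMeasurable m φ) : BoundedMeasurable m (fun x => c * φ x) :=
  (const c).mul h

lemma sub (h : BoundedMeasurable m φ) (h' : BoundedMeasurable m ψ) :
    BoundedMeasurable m (fun x => φ x - ψ x) := by
  simpa only [sub_eq_add_neg, neg_one_mul] using h.add (h'.const_mul (-1))

lemma sq (h : BoundedMeasurable m φ) : BoundedMeasurable m (fun x => φ x ^ 2) := by
  simpa only [pow_two] using h.mul h

lemma exp (h : BoundedMeasurable m φ) : BoundedMeasurable m (fun x => Real.exp (φ x)) := by
  obtain ⟨hm, C, hC⟩ := h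
  refine ⟨Real.measurable_exp.comp hm, Real.exp C, fun x => ?_⟩
  rw [Real.abs_exp]
  exact Real.exp_le_exp.2 ((le_abs_self _).trans (hC x))

lemma abs_rpow (h : BoundedMeasurable m φ) {p : ℝ} (hp : 0 ≤ p) :
    BoundedMeasurable m (fun x => |φ x| ^ p) := by
  obtain ⟨hm, C, hC⟩ := h
  refine ⟨hm.abs.pow_const p, C ^ p, fun x => ?_⟩
  rw [abs_of_nonneg (by positivity)]
  exact Real.rpow_le_rpow (abs_nonneg _) (hC x) hp

lemma sum {ι : Type*} (s : Finset ι) {φ : ι → X → ℝ} (h : ∀ i ∈ s, BoundedMeasurable m (φ i)) :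
    BoundedMeasurable m (fun x => ∑ i ∈ s, φ i x) := by
  choose! C hC using fun i hi => (h i hi).bounded
  exact ⟨Finset.measurable_sum s fun i hi => (h i hi).measurable, ∑ i ∈ s, C i, fun x =>
    (Finset.abs_sum_le_sum_abs _ _).trans (Finset.sum_le_sum fun i hi => hC i hi x)⟩

lemma comp {mY : MeasurableSpace Y} {φ : Y → ℝ} (h : BoundedMeasurable mY φ) {T : X → Y}
    (hT : Measurable[m] T) : BoundedMeasurable m (fun x => φ (T x)) :=
  ⟨h.measurable.comp hT, h.bounded.imp fun _ hC x => hC (T x)⟩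

lemma memLp (h : BoundedMeasurable m φ) (μ : Measure X) [IsFiniteMeasure μ] (p : ENNReal) :
    MemLp φ p μ := by
  obtain ⟨hm, C, hC⟩ := h
  exact MemLp.of_bound hm.aestronglyMeasurable C (Filter.Eventually.of_forall hC)

lemma integrable (h : BoundedMeasurable m φ) (μ : Measure X) [IsFiniteMeasure μ] :
    Integrable φ μ :=
  memLp_one_iff_integrable.1 (h.memLp μ 1)

end BoundedMeasurable

section KernelAction

variable {Z : Type*} [mZ : MeasurableSpace Z] {κ η : Kernel Z Z} {φ : Z → ℝ} {B : ℝ}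

/-- The function `κφ : z ↦ ∫ φ(x) κ(z, dx)`, the action of the kernel `κ` on functions. -/
noncomputable def kernelAvg (κ : Kernel Z Z) (φ : Z → ℝ) (z : Z) : ℝ := ∫ x, φ x ∂(κ z)

lemma abs_integral_le_of_abs_le {μ : Measure Z} [IsProbabilityMeasure μ] (h : ∀ z, |φ z| ≤ B) :
    |∫ z, φ z ∂μ| ≤ B := by
  simpa using norm_integral_le_of_norm_le_const (μ := μ) (f := φ) (C := B)
    (Filter.Eventually.of_forall h)

lemma BoundedMeasurable.kernelAvg (h : BoundedMeasurable mZ φ) (κ : Kernel Z Z)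
    [IsMarkovKernel κ] : BoundedMeasurable mZ (kernelAvg κ φ) := by
  obtain ⟨hm, C, hC⟩ := h
  exact ⟨hm.stronglyMeasurable.integral_kernel.measurable, C, fun _ => abs_integral_le_of_abs_le hC⟩

lemma kernelAvg_pow_zero (hφ : Measurable φ) : kernelAvg (κ ^ 0) φ = φ := by
  funext z
  rw [pow_zero]
  exact integral_dirac' _ _ hφ.stronglyMeasurable

lemma kernelAvg_comp [IsMarkovKernel κ] [IsMarkovKernel η] (h : BoundedMeasurable mZ φ) :
    kernelAvg (η ∘ₖ κ) φ = kernelAvg κ (kernelAvg η φ) :=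
  funext fun _ => Kernel.integral_comp (h.integrable _)

lemma kernelAvg_pow_add [IsMarkovKernel κ] (h : BoundedMeasurable mZ φ) (m n : ℕ) :
    kernelAvg (κ ^ (m + n)) φ = kernelAvg (κ ^ m) (kernelAvg (κ ^ n) φ) := by
  rw [add_comm, pow_add]
  exact kernelAvg_comp h

lemma kernelAvg_mul_sub_const [IsMarkovKernel κ] (h : BoundedMeasurable mZ φ) (a c : ℝ) (z : Z) :
    kernelAvg κ (fun x => a * (φ x - c)) z = a * (kernelAvg κ φ z - c) := by
  simp only [kernelAvg]
  rw [integral_const_mul, integral_sub (h.integrable _) (integrable_const _)]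
  simp

lemma integral_kernelAvg_of_invariant [IsMarkovKernel κ] {π : Measure Z} [IsProbabilityMeasure π]
    (hπ : Kernel.Invariant κ π) (h : BoundedMeasurable mZ φ) :
    ∫ z, kernelAvg κ φ z ∂π = ∫ z, φ z ∂π := by
  conv_rhs => rw [← hπ.def]
  rw [Measure.comp_eq_comp_const_apply, Kernel.integral_comp (h.integrable _)]
  rfl

lemma invariant_pow {π : Measure Z} (hπ : Kernel.Invariant κ π) (n : ℕ) :
    Kernel.Invariant (κ ^ n) π := by
  induction n with
  | zero => rw [pow_zero]; exact Measure.bind_dirac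
  | succ n ih => rw [pow_succ]; exact ih.comp hπ

end KernelAction

section ChainLaw

variable {Z : Type*} [mZ : MeasurableSpace Z]

/-- The trajectory up to time `k`. -/
abbrev pathUpTo (k : ℕ) : (ℕ → Z) → (Finset.Iic k → Z) :=
  Preorder.frestrictLe (π := fun _ : ℕ => Z) k

/-- The filtration on `Z^ℕ` generated by the coordinate process. -/
abbrev history (Z : Type*) [MeasurableSpace Z] :
    Filtration ℕ (inferInstance : MeasurableSpace (ℕ → Z)) :=
  Filtration.piLE (X := fun _ : ℕ => Z)

lemma measurable_pathUpTo (k : ℕ) : Measurable (pathUpTo (Z := Z) k) :=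
  Preorder.measurable_frestrictLe k

lemma exists_eq_comp_pathUpTo {k : ℕ} {W : (ℕ → Z) → ℝ} (hW : Measurable[history Z k] W) :
    ∃ W' : (Finset.Iic k → Z) → ℝ, Measurable W' ∧ W = W' ∘ pathUpTo k := by
  rw [history, Filtration.piLE_eq_comap_frestrictLe] at hW
  exact hW.exists_eq_measurable_comp

lemma BoundedMeasurable.eval {φ : Z → ℝ} (h : BoundedMeasurable mZ φ) {i k : ℕ} (hik : i ≤ k) :
    BoundedMeasurable (history Z k) (fun ω => φ (ω i)) := by
  refine h.comp ?_
  rw [history, Filtration.piLE_eq_comap_frestrictLe]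
  exact (measurable_pi_apply (⟨i, Finset.mem_Iic.2 hik⟩ : Finset.Iic k)).comp
    (comap_measurable (pathUpTo k))

lemma BoundedMeasurable.of_history {k : ℕ} {W : (ℕ → Z) → ℝ}
    (h : BoundedMeasurable (history Z k) W) : BoundedMeasurable MeasurableSpace.pi W :=
  h.mono ((history Z).le k)

variable (Q : Kernel Z Z) [IsMarkovKernel Q] (μ : Measure Z)

instance [IsProbabilityMeasure μ] : IsProbabilityMeasure (chainLaw Q μ) := by
  unfold chainLaw; infer_instance

instance [IsFiniteMeasure μ] : IsFiniteMeasure (chainLaw Q μ) := by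
  unfold chainLaw Kernel.trajMeasure; infer_instance

lemma chainLaw_add (ν : Measure Z) :
    chainLaw Q (μ + ν) = chainLaw Q μ + chainLaw Q ν := by
  rw [chainLaw, Kernel.trajMeasure, Measure.map_add _ _ (by fun_prop), Measure.comp_add]
  rfl

lemma map_chainLaw_zero : (chainLaw Q μ).map (fun ω => ω 0) = μ := by
  have h0 : (fun ω : ℕ → Z => ω 0) = MeasurableEquiv.piUnique (fun _ : Finset.Iic 0 => Z) ∘
      pathUpTo 0 := rfl
  rw [h0, ← Measure.map_map (MeasurableEquiv.measurable _) (by fun_prop), chainLaw,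
    Kernel.trajMeasure, Measure.map_comp _ _ (by fun_prop), Kernel.traj_map_frestrictLe,
    Kernel.partialTraj_self, Measure.id_comp]
  exact MeasurableEquiv.map_map_symm _

lemma measurable_lintegral_last {k : ℕ} {H : (Finset.Iic k → Z) × Z → ENNReal}
    (hH : Measurable H) :
    Measurable fun h : Finset.Iic k → Z =>
      ∫⁻ y, H (h, y) ∂(Q (h ⟨k, Finset.mem_Iic.2 le_rfl⟩)) :=
  hH.lintegral_kernel_prod_right' (κ := Q.comap
    (fun h : Finset.Iic k → Z => h ⟨k, Finset.mem_Iic.2 le_rfl⟩) (by fun_prop))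

theorem lintegral_chainLaw_succ (k : ℕ) {H : (Finset.Iic k → Z) × Z → ENNReal}
    (hH : Measurable H) :
    ∫⁻ ω, H (pathUpTo k ω, ω (k + 1)) ∂(chainLaw Q μ)
      = ∫⁻ ω, ∫⁻ y, H (pathUpTo k ω, y) ∂(Q (ω k)) ∂(chainLaw Q μ) := by
  have hH' : Measurable fun ω : ℕ → Z => ∫⁻ y, H (pathUpTo k ω, y) ∂(Q (ω k)) :=
    (measurable_lintegral_last Q hH).comp (measurable_pathUpTo k)
  rw [chainLaw, Kernel.trajMeasure, Measure.lintegral_bind (by fun_prop) (by fun_prop),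
    Measure.lintegral_bind (by fun_prop) hH'.aemeasurable]
  refine lintegral_congr fun x₀ => ?_
  rw [← lintegral_map hH (g := fun ω : ℕ → Z => (pathUpTo k ω, ω (k + 1))) (by fun_prop),
    ← Kernel.partialTraj_compProd_eq_map_traj (Nat.zero_le k), Measure.lintegral_compProd hH,
    ← Kernel.traj_map_frestrictLe, Kernel.map_apply _ (by fun_prop), lintegral_map _ (by fun_prop)]
  · rfl
  · exact hH.lintegral_kernel_prod_right'

/-- Appends a state to a trajectory up to time `k`. -/
def appendStep (k : ℕ) (x : (Finset.Iic k → Z) × Z) (i : Finset.Iic (k + 1)) : Z :=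
  if h : (i : ℕ) ≤ k then x.1 ⟨i, Finset.mem_Iic.2 h⟩ else x.2

lemma measurable_appendStep (k : ℕ) : Measurable (appendStep (Z := Z) k) := by
  refine measurable_pi_lambda _ fun i => ?_
  unfold appendStep
  split_ifs <;> fun_prop

omit mZ in
lemma appendStep_pathUpTo (k : ℕ) (ω : ℕ → Z) :
    appendStep k (pathUpTo k ω, ω (k + 1)) = pathUpTo (k + 1) ω := by
  funext i
  have hi := Finset.mem_Iic.1 i.2
  unfold appendStep
  split_ifs with h
  · rfl
  · exact congrArg ω (by omega)

theorem eq_chainLaw [IsFiniteMeasure μ] {P : Measure (ℕ → Z)} (h_zero : P.map (fun ω => ω 0) = μ)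
    (h_succ : ∀ (k : ℕ) (H : (Finset.Iic k → Z) × Z → ENNReal), Measurable H →
      ∫⁻ ω, H (pathUpTo k ω, ω (k + 1)) ∂P
        = ∫⁻ ω, ∫⁻ y, H (pathUpTo k ω, y) ∂(Q (ω k)) ∂P) :
    P = chainLaw Q μ := by
  have h_marginal : ∀ k, P.map (pathUpTo k) = (chainLaw Q μ).map (pathUpTo k) := by
    intro k
    induction k with
    | zero =>
      have h0 : pathUpTo (Z := Z) 0 =
          (MeasurableEquiv.piUnique (fun _ : Finset.Iic 0 => Z)).symm ∘ fun ω => ω 0 := by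
        funext ω
        exact ((MeasurableEquiv.piUnique (fun _ : Finset.Iic 0 => Z)).symm_apply_apply _).symm
      rw [h0, ← Measure.map_map (by fun_prop) (by fun_prop), h_zero,
        ← Measure.map_map (by fun_prop) (by fun_prop), map_chainLaw_zero]
    | succ k ih =>
      refine Measure.ext_of_lintegral _ fun F hF => ?_
      have hG : Measurable fun h : Finset.Iic k → Z => ∫⁻ y, F (appendStep k (h, y))
          ∂(Q (h ⟨k, Finset.mem_Iic.2 le_rfl⟩)) :=
        measurable_lintegral_last Q (hF.comp (measurable_appendStep k))
      have h_ih := congrArg (fun ν => ∫⁻ h, ∫⁻ y, F (appendStep k (h, y))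
          ∂(Q (h ⟨k, Finset.mem_Iic.2 le_rfl⟩)) ∂ν) ih
      simp only [lintegral_map hG (measurable_pathUpTo k)] at h_ih
      have hP := h_succ k _ (hF.comp (measurable_appendStep k))
      have hQ := lintegral_chainLaw_succ Q μ k (hF.comp (measurable_appendStep k))
      simp only [Function.comp_apply, appendStep_pathUpTo] at hP hQ
      rw [lintegral_map hF (by fun_prop), lintegral_map hF (by fun_prop), hP, hQ]
      exact h_ih
  refine IsProjectiveLimit.unique (P := fun I => (chainLaw Q μ).map I.restrict) ?_ fun _ => rfl
  exact (isProjectiveLimit_nat_iff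
    (isProjectiveMeasureFamily_map_restrict (X := fun i (ω : ℕ → Z) => ω i) fun _ =>
      (measurable_pi_apply _).aemeasurable) P).2 h_marginal

lemma map_chainLaw_one : (chainLaw Q μ).map (fun ω => ω 1) = Q ∘ₘ μ := by
  refine Measure.ext_of_lintegral _ fun F hF => ?_
  have h_markov := lintegral_chainLaw_succ Q μ 0 (hF.comp measurable_snd)
  have h_start := lintegral_map (μ := chainLaw Q μ) (hF.lintegral_kernel (κ := Q))
    (measurable_pi_apply 0)
  rw [map_chainLaw_zero] at h_start
  rw [lintegral_map hF (by fun_prop), Measure.lintegral_bind (by fun_prop) (by fun_prop), h_start]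
  exact h_markov

lemma map_shift_one_chainLaw [IsFiniteMeasure μ] :
    (chainLaw Q μ).map (fun ω i => ω (i + 1)) = chainLaw Q (Q ∘ₘ μ) := by
  refine eq_chainLaw Q _ ?_ fun k H hH => ?_
  · rw [Measure.map_map (by fun_prop) (by fun_prop)]
    exact map_chainLaw_one Q μ
  · have h_tail : Measurable fun x : (Finset.Iic (k + 1) → Z) × Z =>
        (fun i : Finset.Iic k =>
          x.1 ⟨i + 1, Finset.mem_Iic.2 (Nat.succ_le_succ (Finset.mem_Iic.1 i.2))⟩, x.2) := by
      fun_prop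
    have hF : Measurable fun ω : ℕ → Z => ∫⁻ y, H (pathUpTo k ω, y) ∂(Q (ω k)) :=
      (measurable_lintegral_last Q hH).comp (measurable_pathUpTo k)
    rw [lintegral_map (by fun_prop) (by fun_prop), lintegral_map hF (by fun_prop)]
    exact lintegral_chainLaw_succ Q μ (k + 1) (hH.comp h_tail)

theorem map_shift_chainLaw [IsFiniteMeasure μ] (k : ℕ) :
    (chainLaw Q μ).map (fun ω i => ω (i + k)) = chainLaw Q ((Q ^ k : Kernel Z Z) ∘ₘ μ) := by
  induction k generalizing μ with
  | zero => rw [pow_zero]; exact Measure.map_id.trans (congrArg _ Measure.bind_dirac.symm)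
  | succ k ih =>
    have h_assoc : (Q ^ (k + 1) : Kernel Z Z) ∘ₘ μ = (Q ^ k : Kernel Z Z) ∘ₘ (Q ∘ₘ μ) := by
      rw [pow_succ]
      exact Measure.comp_assoc.symm
    rw [h_assoc, ← ih, ← map_shift_one_chainLaw, Measure.map_map (by fun_prop) (by fun_prop)]
    rfl

end ChainLaw

section Martingale

variable {Z : Type*} [mZ : MeasurableSpace Z] (Q : Kernel Z Z) [IsMarkovKernel Q] (ξ : Measure Z)
  [IsProbabilityMeasure ξ] {k : ℕ} {W : (ℕ → Z) → ℝ} {φ : Z → ℝ}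

lemma integral_mul_eval_succ (hW : BoundedMeasurable (history Z k) W)
    (hφ : BoundedMeasurable mZ φ) :
    ∫ ω, W ω * φ (ω (k + 1)) ∂(chainLaw Q ξ)
      = ∫ ω, W ω * kernelAvg Q φ (ω k) ∂(chainLaw Q ξ) := by
  obtain ⟨W', hW', hWW'⟩ := exists_eq_comp_pathUpTo hW.measurable
  have h_pair : Measurable fun ω : ℕ → Z => (pathUpTo k ω, ω (k + 1)) := by fun_prop
  have h_meas : Measurable fun x : (Finset.Iic k → Z) × Z => W' x.1 * φ x.2 :=
    (hW'.comp measurable_fst).mul (hφ.measurable.comp measurable_snd)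
  have h_int : Integrable (fun x : (Finset.Iic k → Z) × Z => W' x.1 * φ x.2)
      ((chainLaw Q ξ).map fun ω => (pathUpTo k ω, ω (k + 1))) := by
    rw [integrable_map_measure h_meas.aestronglyMeasurable h_pair.aemeasurable]
    have h := hW.of_history.mul (hφ.comp (measurable_pi_apply (k + 1)))
    rw [hWW'] at h
    exact h.integrable _
  have h_law := Kernel.map_frestrictLe_trajMeasure_compProd_eq_map_trajMeasure (μ₀ := ξ)
    (X := fun _ => Z) (a := k) (κ := fun n => Q.comap
      (fun h : Finset.Iic n → Z => h ⟨n, Finset.mem_Iic.2 le_rfl⟩) (measurable_pi_apply _))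
  have h := integral_map (μ := chainLaw Q ξ) h_pair.aemeasurable h_meas.aestronglyMeasurable
  rw [chainLaw, ← h_law] at h h_int
  rw [Measure.integral_compProd h_int, integral_map (by fun_prop)
    h_meas.stronglyMeasurable.integral_kernel_prod_right'.aestronglyMeasurable] at h
  simp only [Kernel.comap_apply, integral_const_mul] at h
  rw [hWW']
  exact h.symm

lemma integral_mul_eval_add (hW : BoundedMeasurable (history Z k) W) (j : ℕ)
    (hφ : BoundedMeasurable mZ φ) :
    ∫ ω, W ω * φ (ω (k + j)) ∂(chainLaw Q ξ)
      = ∫ ω, W ω * kernelAvg (Q ^ j) φ (ω k) ∂(chainLaw Q ξ) := by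
  induction j generalizing φ with
  | zero => simp only [kernelAvg_pow_zero hφ.measurable, add_zero]
  | succ j ih =>
    have hW' := hW.mono ((history Z).mono (Nat.le_add_right k j))
    rw [kernelAvg_pow_add hφ, pow_one, ← ih (hφ.kernelAvg Q), ← integral_mul_eval_succ Q ξ hW' hφ]
    rfl

end Martingale

section TotalVariation

variable {Z : Type*} [mZ : MeasurableSpace Z]

lemma add_negPart_eq_add_posPart (μ ν : Measure Z) [IsFiniteMeasure μ] [IsFiniteMeasure ν] :
    μ + (μ.toSignedMeasure - ν.toSignedMeasure).toJordanDecomposition.negPart =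
      ν + (μ.toSignedMeasure - ν.toSignedMeasure).toJordanDecomposition.posPart := by
  have h := SignedMeasure.toSignedMeasure_toJordanDecomposition
    (μ.toSignedMeasure - ν.toSignedMeasure)
  rw [JordanDecomposition.toSignedMeasure, sub_eq_sub_iff_add_eq_add] at h
  rw [← Measure.toSignedMeasure_eq_toSignedMeasure_iff, Measure.toSignedMeasure_add,
    Measure.toSignedMeasure_add, add_comm ν.toSignedMeasure]
  exact h.symm

theorem abs_integral_sub_le_tvNorm (μ ν : Measure Z) [IsFiniteMeasure μ] [IsFiniteMeasure ν]
    {φ : Z → ℝ} {B : ℝ} (hφ : Measurable φ) (hB : ∀ z, |φ z| ≤ B) :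
    |∫ z, φ z ∂μ - ∫ z, φ z ∂ν| ≤ B * tvNorm μ ν := by
  set j := (μ.toSignedMeasure - ν.toSignedMeasure).toJordanDecomposition
  have hφ' : BoundedMeasurable mZ φ := .of_abs_le hφ hB
  have h_eq := congrArg (fun m => ∫ z, φ z ∂m) (add_negPart_eq_add_posPart μ ν)
  simp only [integral_add_measure (hφ'.integrable _) (hφ'.integrable _)] at h_eq
  have h_bound : ∀ m : Measure Z, [IsFiniteMeasure m] → |∫ z, φ z ∂m| ≤ B * m.real Set.univ :=
    fun m _ => norm_integral_le_of_norm_le_const (f := φ) (Filter.Eventually.of_forall hB)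
  have h_tv : tvNorm μ ν = j.posPart.real Set.univ + j.negPart.real Set.univ :=
    ENNReal.toReal_add (measure_ne_top _ _) (measure_ne_top _ _)
  calc |∫ z, φ z ∂μ - ∫ z, φ z ∂ν| = |∫ z, φ z ∂j.posPart - ∫ z, φ z ∂j.negPart| := by
        congr 1
        linarith
    _ ≤ |∫ z, φ z ∂j.posPart| + |∫ z, φ z ∂j.negPart| := abs_sub _ _
    _ ≤ B * tvNorm μ ν := by
        rw [h_tv, mul_add]
        exact add_le_add (h_bound _) (h_bound _)

lemma IsUniformlyGeometricallyErgodic.abs_kernelAvg_pow_sub_le {Q : Kernel Z Z} [IsMarkovKernel Q]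
    {π : Measure Z} [IsProbabilityMeasure π] {τ : ℕ} (hQ : IsUniformlyGeometricallyErgodic Q π τ)
    {φ : Z → ℝ} {B : ℝ} (hφ : Measurable φ) (hB : ∀ z, |φ z| ≤ B) (n : ℕ) (z : Z) :
    |kernelAvg (Q ^ n) φ z - ∫ x, φ x ∂π| ≤ 2 * B * (1 / 4) ^ (n / τ) := by
  have hB₀ : 0 ≤ B := (abs_nonneg _).trans (hB z)
  calc |kernelAvg (Q ^ n) φ z - ∫ x, φ x ∂π| ≤ B * tvNorm ((Q ^ n) z) π :=
        abs_integral_sub_le_tvNorm _ _ hφ hB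
    _ = 2 * B * (1 / 2 * tvNorm ((Q ^ n) z) π) := by ring
    _ ≤ 2 * B * (1 / 4) ^ (n / τ) := by
        gcongr
        exact hQ.tv_le n z

end TotalVariation

section Potential

lemma hasSum_pow_div {r : ℝ} (hr₀ : 0 ≤ r) (hr₁ : r < 1) {τ : ℕ} (hτ : 0 < τ) :
    HasSum (fun k : ℕ => r ^ (k / τ)) ((1 - r)⁻¹ * τ) := by
  have : NeZero τ := ⟨hτ.ne'⟩
  have h_geom := hasSum_geometric_of_lt_one hr₀ hr₁
  have h_const : HasSum (fun _ : Fin τ => (1 : ℝ)) τ := by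
    simpa using hasSum_fintype fun _ : Fin τ => (1 : ℝ)
  have h_prod := h_geom.mul h_const (h_geom.summable.mul_of_nonneg h_const.summable
    (fun k => by positivity) fun _ => zero_le_one)
  rw [← (Nat.divModEquiv τ).symm.hasSum_iff]
  refine h_prod.congr_fun fun x => ?_
  have h_div : (x.1 * τ + x.2) / τ = x.1 := by
    rw [mul_comm, Nat.mul_add_div hτ, Nat.div_eq_of_lt x.2.2, add_zero]
  simp [Nat.divModEquiv, h_div]

lemma hasSum_integral_of_abs_le {X : Type*} [MeasurableSpace X] (μ : Measure X)
    [IsProbabilityMeasure μ] {F : ℕ → X → ℝ} {a : ℕ → ℝ} (ha : Summable a)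
    (hF : ∀ k, Measurable (F k)) (hFa : ∀ k x, |F k x| ≤ a k) :
    HasSum (fun k => ∫ x, F k x ∂μ) (∫ x, ∑' k, F k x ∂μ) := by
  have h_int : ∀ k, Integrable (F k) μ := fun k =>
    (BoundedMeasurable.of_abs_le (hF k) (hFa k)).integrable μ
  refine hasSum_integral_of_summable_integral_norm h_int
    (Summable.of_nonneg_of_le (fun k => integral_nonneg fun _ => norm_nonneg _) (fun k => ?_) ha)
  simpa using integral_mono (h_int k).norm (integrable_const (a k)) (hFa k)

variable {Z : Type*} [mZ : MeasurableSpace Z]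

/-- The potential `∑ₖ κ^k φ` of a function `φ`, which solves the Poisson equation `g - κ g = φ` when
the series is dominated by a summable sequence. -/
noncomputable def potential (κ : Kernel Z Z) (φ : Z → ℝ) (z : Z) : ℝ :=
  ∑' k : ℕ, kernelAvg (κ ^ k) φ z

variable {κ : Kernel Z Z} {φ : Z → ℝ} {a : ℕ → ℝ} {A : ℝ}

lemma abs_potential_le (ha : HasSum a A) (hφa : ∀ k z, |kernelAvg (κ ^ k) φ z| ≤ a k) (z : Z) :
    |potential κ φ z| ≤ A :=
  tsum_of_norm_bounded (f := fun k => kernelAvg (κ ^ k) φ z) ha fun k => hφa k z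

variable [IsMarkovKernel κ]

lemma BoundedMeasurable.potential (hφ : BoundedMeasurable mZ φ) (ha : HasSum a A)
    (hφa : ∀ k z, |MarkovRosenthal.kernelAvg (κ ^ k) φ z| ≤ a k) :
    BoundedMeasurable mZ (potential κ φ) := by
  refine .of_abs_le ?_ (abs_potential_le ha hφa)
  have h_sum : ∀ z, Summable fun k => MarkovRosenthal.kernelAvg (κ ^ k) φ z := fun z =>
    Summable.of_norm_bounded ha.summable fun k => hφa k z
  exact measurable_of_tendsto_metrizable
    (fun n => Finset.measurable_sum (Finset.range n) fun k _ => (hφ.kernelAvg (κ ^ k)).measurable)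
    (tendsto_pi_nhds.2 fun z => by simpa using! (h_sum z).hasSum.tendsto_sum_nat)

theorem potential_sub_kernelAvg (hφ : BoundedMeasurable mZ φ) (ha : Summable a)
    (hφa : ∀ k z, |kernelAvg (κ ^ k) φ z| ≤ a k) (z : Z) :
    potential κ φ z - kernelAvg κ (potential κ φ) z = φ z := by
  have h_sum : Summable fun k => kernelAvg (κ ^ k) φ z :=
    Summable.of_norm_bounded ha fun k => hφa k z
  have h_tail : kernelAvg κ (potential κ φ) z = ∑' k, kernelAvg (κ ^ (k + 1)) φ z := by
    simp only [add_comm _ 1, kernelAvg_pow_add hφ, pow_one]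
    exact (hasSum_integral_of_abs_le (κ z) ha (fun k => (hφ.kernelAvg (κ ^ k)).measurable)
      hφa).tsum_eq.symm
  rw [h_tail, potential, h_sum.tsum_eq_zero_add, kernelAvg_pow_zero hφ.measurable]
  ring

lemma hasSum_integral_mul_potential (μ : Measure Z) [IsProbabilityMeasure μ] {ψ : Z → ℝ}
    (hψ : BoundedMeasurable mZ ψ) (hφ : BoundedMeasurable mZ φ) (ha : Summable a)
    (hφa : ∀ k z, |kernelAvg (κ ^ k) φ z| ≤ a k) :
    HasSum (fun k => ∫ z, ψ z * kernelAvg (κ ^ k) φ z ∂μ) (∫ z, ψ z * potential κ φ z ∂μ) := by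
  obtain ⟨C, hC⟩ := hψ.bounded
  simp only [potential, ← tsum_mul_left]
  refine hasSum_integral_of_abs_le μ (ha.mul_left C)
    (fun k => hψ.measurable.mul (hφ.kernelAvg (κ ^ k)).measurable) fun k z => ?_
  rw [abs_mul]
  exact mul_le_mul (hC z) (hφa k z) (abs_nonneg _) ((abs_nonneg _).trans (hC z))

end Potential

section MartingaleBlock

variable {Z : Type*} [mZ : MeasurableSpace Z]

/-- The one-step conditional variance `Q g² - (Q g)²` of `g`, as a function of the current state. -/
noncomputable def stepVar (Q : Kernel Z Z) (g : Z → ℝ) (z : Z) : ℝ := variance g (Q z)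

/-- The sum of the expected one-step conditional variances of `g` over `n` steps, as a function of
the initial state. -/
noncomputable def blockVar (Q : Kernel Z Z) (g : Z → ℝ) (n : ℕ) (z : Z) : ℝ :=
  ∑ j ∈ Finset.range n, kernelAvg (Q ^ j) (stepVar Q g) z

/-- The martingale increment `g(Z_{k+1}) - Q g(Z_k)`. -/
noncomputable def martingaleIncr (Q : Kernel Z Z) (g : Z → ℝ) (k : ℕ) (ω : ℕ → Z) : ℝ :=
  g (ω (k + 1)) - kernelAvg Q g (ω k)

/-- The sum of the `n` martingale increments from time `k` on. -/
noncomputable def martingaleBlock (Q : Kernel Z Z) (g : Z → ℝ) (k n : ℕ) (ω : ℕ → Z) : ℝ :=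
  ∑ j ∈ Finset.range n, martingaleIncr Q g (k + j) ω

variable {Q : Kernel Z Z} {g : Z → ℝ}

lemma martingaleBlock_succ (k n : ℕ) (ω : ℕ → Z) :
    martingaleBlock Q g k (n + 1) ω = martingaleBlock Q g k n ω + martingaleIncr Q g (k + n) ω :=
  Finset.sum_range_succ _ _

lemma martingaleBlock_add (k m n : ℕ) (ω : ℕ → Z) :
    martingaleBlock Q g k (m + n) ω
      = martingaleBlock Q g k m ω + martingaleBlock Q g (k + m) n ω := by
  simp only [martingaleBlock, Finset.sum_range_add, add_assoc]

lemma martingaleBlock_eq_sum (k n : ℕ) (ω : ℕ → Z) :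
    martingaleBlock Q g k n ω
      = (∑ j ∈ Finset.range n, (g (ω (k + j)) - kernelAvg Q g (ω (k + j))))
        + (g (ω (k + n)) - g (ω k)) := by
  have h_telescope := Finset.sum_range_sub (fun j => g (ω (k + j))) n
  rw [add_zero] at h_telescope
  rw [← h_telescope, ← Finset.sum_add_distrib]
  exact Finset.sum_congr rfl fun j _ => by rw [martingaleIncr, add_assoc]; ring

variable [IsMarkovKernel Q]

lemma stepVar_eq (hg : BoundedMeasurable mZ g) (z : Z) :
    stepVar Q g z = kernelAvg Q (fun x => g x ^ 2) z - kernelAvg Q g z ^ 2 :=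
  variance_eq_sub (hg.memLp _ 2)

lemma BoundedMeasurable.stepVar (hg : BoundedMeasurable mZ g) :
    BoundedMeasurable mZ (stepVar Q g) := by
  rw [funext (stepVar_eq hg)]
  exact (hg.sq.kernelAvg Q).sub (hg.kernelAvg Q).sq

lemma BoundedMeasurable.blockVar (hg : BoundedMeasurable mZ g) (n : ℕ) :
    BoundedMeasurable mZ (blockVar Q g n) :=
  .sum _ fun j _ => hg.stepVar.kernelAvg (Q ^ j)

lemma BoundedMeasurable.martingaleIncr (hg : BoundedMeasurable mZ g) (k : ℕ) :
    BoundedMeasurable (history Z (k + 1)) (martingaleIncr Q g k) :=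
  (hg.eval le_rfl).sub ((hg.kernelAvg Q).eval k.le_succ)

lemma BoundedMeasurable.martingaleBlock (hg : BoundedMeasurable mZ g) (k n : ℕ) :
    BoundedMeasurable (history Z (k + n)) (martingaleBlock Q g k n) :=
  .sum _ fun j hj => (hg.martingaleIncr (k + j)).mono
    ((history Z).mono (by have := Finset.mem_range.1 hj; omega))

section Orthogonality

variable (ξ : Measure Z) [IsProbabilityMeasure ξ] {k : ℕ} {W : (ℕ → Z) → ℝ}

lemma integral_mul_martingaleIncr (hg : BoundedMeasurable mZ g)
    (hW : BoundedMeasurable (history Z k) W) :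
    ∫ ω, W ω * martingaleIncr Q g k ω ∂(chainLaw Q ξ) = 0 := by
  have h_next := hW.of_history.mul (hg.comp (measurable_pi_apply (k + 1)))
  have h_now := hW.of_history.mul ((hg.kernelAvg Q).comp (measurable_pi_apply k))
  simp only [martingaleIncr, mul_sub]
  rw [integral_sub (h_next.integrable _) (h_now.integrable _), integral_mul_eval_succ Q ξ hW hg,
    sub_self]

lemma integral_mul_martingaleIncr_sq (hg : BoundedMeasurable mZ g)
    (hW : BoundedMeasurable (history Z k) W) :
    ∫ ω, W ω * martingaleIncr Q g k ω ^ 2 ∂(chainLaw Q ξ)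
      = ∫ ω, W ω * stepVar Q g (ω k) ∂(chainLaw Q ξ) := by
  have h_drift : BoundedMeasurable (history Z k) fun ω => W ω * kernelAvg Q g (ω k) :=
    hW.mul ((hg.kernelAvg Q).eval le_rfl)
  have h_next := hW.of_history.mul (hg.sq.comp (measurable_pi_apply (k + 1)))
  have h_now := hW.of_history.mul ((hg.sq.kernelAvg Q).comp (measurable_pi_apply k))
  have h_cross := (h_drift.mul ((hg.kernelAvg Q).eval le_rfl)).of_history
  have h_incr := ((h_drift.mono ((history Z).mono k.le_succ)).mul
    (hg.martingaleIncr (Q := Q) k)).of_history.const_mul 2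
  have h_expand : ∀ ω, W ω * martingaleIncr Q g k ω ^ 2 = W ω * g (ω (k + 1)) ^ 2
      - (W ω * kernelAvg Q g (ω k) * kernelAvg Q g (ω k)
        + 2 * (W ω * kernelAvg Q g (ω k) * martingaleIncr Q g k ω)) := fun ω => by
    simp only [martingaleIncr]
    ring
  have h_var : ∀ ω, W ω * stepVar Q g (ω k) = W ω * kernelAvg Q (fun x => g x ^ 2) (ω k)
      - W ω * kernelAvg Q g (ω k) * kernelAvg Q g (ω k) := fun ω => by
    rw [stepVar_eq hg]
    ring
  simp only [h_expand, h_var]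
  rw [integral_sub (h_next.integrable _) ((h_cross.add h_incr).integrable _),
    integral_add (h_cross.integrable _) (h_incr.integrable _),
    integral_const_mul, integral_mul_martingaleIncr ξ hg h_drift, mul_zero, add_zero,
    integral_mul_eval_succ Q ξ hW hg.sq, integral_sub (h_now.integrable _) (h_cross.integrable _)]

lemma integral_mul_martingaleBlock (hg : BoundedMeasurable mZ g)
    (hW : BoundedMeasurable (history Z k) W) (n : ℕ) :
    ∫ ω, W ω * martingaleBlock Q g k n ω ∂(chainLaw Q ξ) = 0 := by
  simp only [martingaleBlock, Finset.mul_sum]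
  have hW' : ∀ j, BoundedMeasurable (history Z (k + j)) W := fun j =>
    hW.mono ((history Z).mono (Nat.le_add_right k j))
  rw [integral_finsetSum _ fun j _ =>
    (hW.of_history.mul (hg.martingaleIncr (k + j)).of_history).integrable _]
  exact Finset.sum_eq_zero fun j _ => integral_mul_martingaleIncr ξ hg (hW' j)

theorem integral_mul_martingaleBlock_sq (hg : BoundedMeasurable mZ g)
    (hW : BoundedMeasurable (history Z k) W) (n : ℕ) :
    ∫ ω, W ω * martingaleBlock Q g k n ω ^ 2 ∂(chainLaw Q ξ)
      = ∫ ω, W ω * blockVar Q g n (ω k) ∂(chainLaw Q ξ) := by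
  induction n with
  | zero => simp [martingaleBlock, blockVar]
  | succ n ih =>
    have hW' := hW.mono ((history Z).mono (Nat.le_add_right k n))
    have h_prev := hW'.mul (hg.martingaleBlock (Q := Q) k n)
    have h_incr := hg.martingaleIncr (Q := Q) (k + n)
    have h_sq := (hW'.mul (hg.martingaleBlock (Q := Q) k n).sq).of_history
    have h_incr_sq := hW.of_history.mul h_incr.sq.of_history
    have h_cross := h_prev.of_history.mul h_incr.of_history
    have h_expand : ∀ ω, W ω * martingaleBlock Q g k (n + 1) ω ^ 2
        = W ω * martingaleBlock Q g k n ω ^ 2 + (W ω * martingaleIncr Q g (k + n) ω ^ 2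
          + 2 * (W ω * martingaleBlock Q g k n ω * martingaleIncr Q g (k + n) ω)) := fun ω => by
      rw [martingaleBlock_succ]
      ring
    have h_var : ∀ ω, W ω * blockVar Q g (n + 1) (ω k) = W ω * blockVar Q g n (ω k)
        + W ω * kernelAvg (Q ^ n) (stepVar Q g) (ω k) := fun ω => by
      rw [blockVar, Finset.sum_range_succ, mul_add, blockVar]
    simp only [h_expand, h_var]
    rw [integral_add (h_sq.integrable _) ((h_incr_sq.add (h_cross.const_mul 2)).integrable _),
      integral_add (h_incr_sq.integrable _) ((h_cross.const_mul 2).integrable _),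
      integral_const_mul, integral_mul_martingaleIncr ξ hg h_prev, mul_zero, add_zero, ih,
      integral_mul_martingaleIncr_sq ξ hg hW', integral_mul_eval_add Q ξ hW n hg.stepVar,
      integral_add ((hW.mul ((hg.blockVar n).eval le_rfl)).of_history.integrable _)
        ((hW.mul ((hg.stepVar.kernelAvg (Q ^ n)).eval le_rfl)).of_history.integrable _)]

end Orthogonality

lemma integral_blockVar {π : Measure Z} [IsProbabilityMeasure π] (hπ : Kernel.Invariant Q π)
    (hg : BoundedMeasurable mZ g) (n : ℕ) :
    ∫ z, blockVar Q g n z ∂π = n * ∫ z, stepVar Q g z ∂π := by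
  simp only [blockVar]
  rw [integral_finsetSum _ fun j _ => (hg.stepVar.kernelAvg (Q ^ j)).integrable π]
  simp [integral_kernelAvg_of_invariant (invariant_pow hπ _) (hg.stepVar (Q := Q))]

lemma blockVar_eq_integral (hg : BoundedMeasurable mZ g) (n : ℕ) (z : Z) :
    blockVar Q g n z
      = ∫ ω, martingaleBlock Q g 0 n ω ^ 2 ∂(chainLaw Q (Measure.dirac z)) := by
  have h_sq := integral_mul_martingaleBlock_sq (Q := Q) (Measure.dirac z) hg (k := 0) (.const 1) n
  have h_start := integral_map (μ := chainLaw Q (Measure.dirac z)) (φ := fun ω => ω 0)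
    (measurable_pi_apply 0).aemeasurable (hg.blockVar (Q := Q) n).measurable.aestronglyMeasurable
  rw [map_chainLaw_zero, integral_dirac' _ _ (hg.blockVar n).measurable.stronglyMeasurable]
    at h_start
  simp only [one_mul] at h_sq
  rw [h_start, h_sq]

lemma abs_blockVar_le (hg : BoundedMeasurable mZ g) {n : ℕ} {L : ℝ}
    (hL : ∀ ω, |martingaleBlock Q g 0 n ω| ≤ L) (z : Z) : |blockVar Q g n z| ≤ L ^ 2 := by
  rw [blockVar_eq_integral hg]
  refine abs_integral_le_of_abs_le fun ω => ?_
  rw [abs_pow]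
  exact pow_le_pow_left₀ (abs_nonneg _) (hL ω) 2

end MartingaleBlock

section ExponentialMoment

lemma exp_add_le {x y : ℝ} (h : |x + y| ≤ 1) :
    Real.exp (x + y) ≤ 1 + x + y + 2 * x ^ 2 + 2 * y ^ 2 := by
  have h_taylor := (abs_le.1 (Real.abs_exp_sub_one_sub_id_le h)).2
  nlinarith [sq_nonneg (x - y)]

variable {Z : Type*} [mZ : MeasurableSpace Z] {Q : Kernel Z Z} {g u : Z → ℝ} {U V L θ : ℝ}
  {n : ℕ}

/-- The exponential process `exp(θ Mₖ + θ² u(Zₖ))`, where `Mₖ` is the sum of the first `k`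
martingale increments of `g` and `u` is meant to compensate the quadratic variation of `M`. -/
noncomputable def expProcess (Q : Kernel Z Z) (g u : Z → ℝ) (θ : ℝ) (k : ℕ) (ω : ℕ → Z) : ℝ :=
  Real.exp (θ * martingaleBlock Q g 0 k ω + θ ^ 2 * u (ω k))

lemma expProcess_add_le (hU : ∀ z, |u z| ≤ U) (hL : ∀ k ω, |martingaleBlock Q g k n ω| ≤ L)
    (hθ : |θ| * L + θ ^ 2 * (2 * U) ≤ 1) (k : ℕ) (ω : ℕ → Z) :
    expProcess Q g u θ (k + n) ω ≤ expProcess Q g u θ k ω * (1 + 8 * θ ^ 4 * U ^ 2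
      + θ * martingaleBlock Q g k n ω
      + θ ^ 2 * (u (ω (k + n)) - u (ω k) + 2 * martingaleBlock Q g k n ω ^ 2)) := by
  set D := martingaleBlock Q g k n ω
  set δ := u (ω (k + n)) - u (ω k) with hδ_def
  have h_factor : expProcess Q g u θ (k + n) ω
      = expProcess Q g u θ k ω * Real.exp (θ * D + θ ^ 2 * δ) := by
    rw [expProcess, expProcess, ← Real.exp_add, martingaleBlock_add, zero_add, hδ_def]
    congr 1
    ring
  have hδ : |δ| ≤ 2 * U := (abs_sub _ _).trans (by linarith [hU (ω (k + n)), hU (ω k)])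
  have h_small : |θ * D + θ ^ 2 * δ| ≤ 1 := calc
    |θ * D + θ ^ 2 * δ| ≤ |θ| * |D| + θ ^ 2 * |δ| := by
        refine (abs_add_le _ _).trans_eq ?_
        rw [abs_mul, abs_mul, abs_of_nonneg (sq_nonneg θ)]
    _ ≤ |θ| * L + θ ^ 2 * (2 * U) := by
        gcongr
        exact hL k ω
    _ ≤ 1 := hθ
  have hδ_sq : θ ^ 4 * δ ^ 2 ≤ θ ^ 4 * (2 * U) ^ 2 :=
    mul_le_mul_of_nonneg_left (sq_le_sq.2 (hδ.trans (le_abs_self _))) (by positivity)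
  rw [h_factor]
  refine mul_le_mul_of_nonneg_left ?_ (Real.exp_pos _).le
  linarith [exp_add_le h_small]

variable [IsMarkovKernel Q]

lemma BoundedMeasurable.expProcess (hg : BoundedMeasurable mZ g) (hu : BoundedMeasurable mZ u)
    (θ : ℝ) (k : ℕ) : BoundedMeasurable (history Z k) (expProcess Q g u θ k) := by
  have h_block := hg.martingaleBlock (Q := Q) 0 k
  rw [zero_add] at h_block
  exact ((h_block.const_mul θ).add ((hu.eval le_rfl).const_mul (θ ^ 2))).exp

variable (ξ : Measure Z) [IsProbabilityMeasure ξ]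

lemma integral_mul_compensated_sq (hg : BoundedMeasurable mZ g) (hu : BoundedMeasurable mZ u)
    (h_poisson : ∀ z, u z - kernelAvg (Q ^ n) u z = 2 * (blockVar Q g n z - V)) {k : ℕ}
    {W : (ℕ → Z) → ℝ} (hW : BoundedMeasurable (history Z k) W) :
    ∫ ω, W ω * (u (ω (k + n)) - u (ω k) + 2 * martingaleBlock Q g k n ω ^ 2) ∂(chainLaw Q ξ)
      = 2 * V * ∫ ω, W ω ∂(chainLaw Q ξ) := by
  have h_next := hW.of_history.mul (hu.comp (measurable_pi_apply (k + n)))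
  have h_now := hW.of_history.mul (hu.comp (measurable_pi_apply k))
  have h_sq := hW.of_history.mul (hg.martingaleBlock (Q := Q) k n).of_history.sq
  have h_avg := hW.of_history.mul ((hu.kernelAvg (Q ^ n)).comp (measurable_pi_apply k))
  have h_var := hW.of_history.mul ((hg.blockVar (Q := Q) n).comp (measurable_pi_apply k))
  calc
    _ = ∫ ω, (W ω * u (ω (k + n)) - W ω * u (ω k)
          + 2 * (W ω * martingaleBlock Q g k n ω ^ 2)) ∂(chainLaw Q ξ) := by
        congr 1 with ω
        ring
    _ = ∫ ω, (W ω * kernelAvg (Q ^ n) u (ω k) - W ω * u (ω k)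
          + 2 * (W ω * blockVar Q g n (ω k))) ∂(chainLaw Q ξ) := by
        rw [integral_add ((h_next.sub h_now).integrable _) ((h_sq.const_mul 2).integrable _),
          integral_add ((h_avg.sub h_now).integrable _) ((h_var.const_mul 2).integrable _),
          integral_sub (h_next.integrable _) (h_now.integrable _),
          integral_sub (h_avg.integrable _) (h_now.integrable _), integral_const_mul,
          integral_const_mul, integral_mul_eval_add Q ξ hW n hu,
          integral_mul_martingaleBlock_sq ξ hg hW]
    _ = ∫ ω, 2 * V * W ω ∂(chainLaw Q ξ) := by
        congr 1 with ω
        linear_combination (-W ω) * h_poisson (ω k)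
    _ = _ := integral_const_mul _ _

lemma integral_expProcess_add_le (hg : BoundedMeasurable mZ g) (hu : Measurable u)
    (hU : ∀ z, |u z| ≤ U) (hL : ∀ k ω, |martingaleBlock Q g k n ω| ≤ L)
    (h_poisson : ∀ z, u z - kernelAvg (Q ^ n) u z = 2 * (blockVar Q g n z - V))
    (hθ : |θ| * L + θ ^ 2 * (2 * U) ≤ 1) (k : ℕ) :
    ∫ ω, expProcess Q g u θ (k + n) ω ∂(chainLaw Q ξ)
      ≤ Real.exp (2 * θ ^ 2 * V + 8 * θ ^ 4 * U ^ 2)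
        * ∫ ω, expProcess Q g u θ k ω ∂(chainLaw Q ξ) := by
  have hu' : BoundedMeasurable mZ u := .of_abs_le hu hU
  have hE := hg.expProcess hu' θ (Q := Q)
  have h_const := (hE k).of_history.const_mul (1 + 8 * θ ^ 4 * U ^ 2)
  have h_block := ((hE k).of_history.mul (hg.martingaleBlock (Q := Q) k n).of_history).const_mul θ
  have h_comp := ((hE k).of_history.mul (((hu'.comp (measurable_pi_apply (k + n))).sub
    (hu'.comp (measurable_pi_apply k))).add
      ((hg.martingaleBlock (Q := Q) k n).of_history.sq.const_mul 2))).const_mul (θ ^ 2)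
  calc ∫ ω, expProcess Q g u θ (k + n) ω ∂(chainLaw Q ξ)
    _ ≤ ∫ ω, ((1 + 8 * θ ^ 4 * U ^ 2) * expProcess Q g u θ k ω
          + θ * (expProcess Q g u θ k ω * martingaleBlock Q g k n ω)
          + θ ^ 2 * (expProcess Q g u θ k ω * (u (ω (k + n)) - u (ω k)
            + 2 * martingaleBlock Q g k n ω ^ 2))) ∂(chainLaw Q ξ) := by
        refine integral_mono ((hE (k + n)).of_history.integrable _)
          (((h_const.add h_block).add h_comp).integrable _) fun ω => ?_
        exact (expProcess_add_le hU hL hθ k ω).trans_eq (by ring)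
    _ = (1 + (2 * θ ^ 2 * V + 8 * θ ^ 4 * U ^ 2))
          * ∫ ω, expProcess Q g u θ k ω ∂(chainLaw Q ξ) := by
        rw [integral_add ((h_const.add h_block).integrable _) (h_comp.integrable _),
          integral_add (h_const.integrable _) (h_block.integrable _), integral_const_mul,
          integral_const_mul, integral_const_mul, integral_mul_martingaleBlock ξ hg (hE k),
          integral_mul_compensated_sq ξ hg hu' h_poisson (hE k)]
        ring
    _ ≤ _ := by
        refine mul_le_mul_of_nonneg_right ?_ (integral_nonneg fun _ => (Real.exp_pos _).le)
        linarith [Real.add_one_le_exp (2 * θ ^ 2 * V + 8 * θ ^ 4 * U ^ 2)]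

lemma integral_expProcess_le (hg : BoundedMeasurable mZ g) (hu : Measurable u)
    (hU : ∀ z, |u z| ≤ U) (hL : ∀ k ω, |martingaleBlock Q g k n ω| ≤ L)
    (h_poisson : ∀ z, u z - kernelAvg (Q ^ n) u z = 2 * (blockVar Q g n z - V))
    (hθ : |θ| * L + θ ^ 2 * (2 * U) ≤ 1) (m : ℕ) :
    ∫ ω, expProcess Q g u θ (m * n) ω ∂(chainLaw Q ξ)
      ≤ Real.exp (m * (2 * θ ^ 2 * V + 8 * θ ^ 4 * U ^ 2) + θ ^ 2 * U) := by
  induction m with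
  | zero =>
    have h_start : ∀ ω, expProcess Q g u θ 0 ω ≤ Real.exp (θ ^ 2 * U) := fun ω => by
      simp only [expProcess, martingaleBlock, Finset.range_zero, Finset.sum_empty, mul_zero,
        zero_add]
      gcongr
      exact (le_abs_self _).trans (hU _)
    simpa using integral_mono ((hg.expProcess (.of_abs_le hu hU) θ 0).of_history.integrable
      (chainLaw Q ξ)) (integrable_const _) h_start
  | succ m ih =>
    calc ∫ ω, expProcess Q g u θ ((m + 1) * n) ω ∂(chainLaw Q ξ)
      _ ≤ Real.exp (2 * θ ^ 2 * V + 8 * θ ^ 4 * U ^ 2)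
            * ∫ ω, expProcess Q g u θ (m * n) ω ∂(chainLaw Q ξ) := by
          rw [Nat.succ_mul]
          exact integral_expProcess_add_le ξ hg hu hU hL h_poisson hθ (m * n)
      _ ≤ Real.exp (2 * θ ^ 2 * V + 8 * θ ^ 4 * U ^ 2)
            * Real.exp (m * (2 * θ ^ 2 * V + 8 * θ ^ 4 * U ^ 2) + θ ^ 2 * U) := by gcongr
      _ = _ := by
          rw [← Real.exp_add]
          push_cast
          ring_nf

theorem integral_exp_sum_le {G : ℝ} (hg : Measurable g) (hG : ∀ z, |g z| ≤ G) (hu : Measurable u)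
    (hU : ∀ z, |u z| ≤ U) (hL : ∀ k ω, |martingaleBlock Q g k n ω| ≤ L)
    (h_poisson : ∀ z, u z - kernelAvg (Q ^ n) u z = 2 * (blockVar Q g n z - V))
    (hθ : |θ| * L + θ ^ 2 * (2 * U) ≤ 1) (m : ℕ) :
    ∫ ω, Real.exp (θ * ∑ i ∈ Finset.range (m * n), (g (ω i) - kernelAvg Q g (ω i)))
        ∂(chainLaw Q ξ)
      ≤ Real.exp (m * (2 * θ ^ 2 * V + 8 * θ ^ 4 * U ^ 2) + 2 * (|θ| * G + θ ^ 2 * U)) := by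
  have hg' : BoundedMeasurable mZ g := .of_abs_le hg hG
  have h_int : BoundedMeasurable MeasurableSpace.pi fun ω : ℕ → Z =>
      Real.exp (θ * ∑ i ∈ Finset.range (m * n), (g (ω i) - kernelAvg Q g (ω i))) :=
    ((BoundedMeasurable.sum _ fun i _ => (hg'.sub (hg'.kernelAvg Q)).comp
      (measurable_pi_apply i)).const_mul θ).exp
  have h_edge : ∀ ω : ℕ → Z,
      Real.exp (θ * ∑ i ∈ Finset.range (m * n), (g (ω i) - kernelAvg Q g (ω i)))
        ≤ Real.exp (2 * |θ| * G + θ ^ 2 * U) * expProcess Q g u θ (m * n) ω := by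
    intro ω
    rw [expProcess, ← Real.exp_add, Real.exp_le_exp, martingaleBlock_eq_sum]
    have h_abs : ∀ z, |θ * g z| ≤ |θ| * G := fun z => by
      rw [abs_mul]
      exact mul_le_mul_of_nonneg_left (hG z) (abs_nonneg θ)
    have hu_sq := mul_le_mul_of_nonneg_left (abs_le.1 (hU (ω (m * n)))).1 (sq_nonneg θ)
    simp only [zero_add]
    linarith [(abs_le.1 (h_abs (ω 0))).2, (abs_le.1 (h_abs (ω (m * n)))).1]
  have h_proc := (hg'.expProcess (Q := Q) (.of_abs_le hu hU) θ (m * n)).of_history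
  refine (integral_mono (h_int.integrable _) ((h_proc.const_mul _).integrable _) h_edge).trans ?_
  rw [integral_const_mul]
  refine (mul_le_mul_of_nonneg_left (integral_expProcess_le ξ hg' hu hU hL h_poisson hθ m)
    (Real.exp_pos _).le).trans_eq ?_
  rw [← Real.exp_add]
  ring_nf

end ExponentialMoment

section CenteredSum

variable {Z : Type*} [mZ : MeasurableSpace Z] {π : Measure Z} {f : Z → ℝ}

lemma BoundedMeasurable.centered (hf : BoundedMeasurable mZ f) :
    BoundedMeasurable mZ (centered π f) :=
  hf.sub (.const _)

lemma BoundedMeasurable.centeredSum (hf : BoundedMeasurable mZ f) (n : ℕ) :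
    BoundedMeasurable MeasurableSpace.pi (centeredSum π f n) :=
  .sum _ fun i _ => hf.centered.comp (measurable_pi_apply i)

lemma centeredSum_add (m n : ℕ) (ω : ℕ → Z) :
    centeredSum π f (m + n) ω = centeredSum π f m ω + centeredSum π f n (fun i => ω (i + m)) := by
  simp only [centeredSum, Finset.sum_range_add, add_comm _ m]

variable [IsProbabilityMeasure π]

lemma abs_centered_le (hf₁ : ∀ z, |f z| ≤ 1) (z : Z) : |centered π f z| ≤ 2 :=
  (abs_sub _ _).trans (by linarith [hf₁ z, abs_integral_le_of_abs_le (μ := π) hf₁])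

lemma abs_centeredSum_le (hf₁ : ∀ z, |f z| ≤ 1) (n : ℕ) (ω : ℕ → Z) :
    |centeredSum π f n ω| ≤ 2 * n := by
  calc |centeredSum π f n ω| ≤ ∑ i ∈ Finset.range n, |centered π f (ω i)| :=
        Finset.abs_sum_le_sum_abs _ _
    _ ≤ ∑ _i ∈ Finset.range n, 2 := Finset.sum_le_sum fun i _ => abs_centered_le hf₁ (ω i)
    _ = 2 * n := by simp [mul_comm]

lemma hasSum_mul_one_fourth_pow (c : ℝ) :
    HasSum (fun k : ℕ => c * (1 / 4) ^ k) (c * (4 / 3)) := by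
  have h := (hasSum_geometric_of_lt_one (r := (1 / 4 : ℝ)) (by norm_num) (by norm_num)).mul_left c
  norm_num at h ⊢
  exact h

/-- The solution `u` of the Poisson equation `u - Q^τ u = 2 (v - π(v))`, where `v` is the quadratic
variation over `τ` steps of the martingale attached to `f - π(f)`. -/
noncomputable def compensator (Q : Kernel Z Z) (π : Measure Z) (f : Z → ℝ) (τ : ℕ) :
    Z → ℝ :=
  potential (Q ^ τ) fun z => 2 * (blockVar Q (potential Q (centered π f)) τ z
    - ∫ x, blockVar Q (potential Q (centered π f)) τ x ∂π)

variable {Q : Kernel Z Z} [IsMarkovKernel Q] {τ : ℕ}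

namespace IsUniformlyGeometricallyErgodic

section AsymptoticVariance

lemma hasSum_rate (hQ : IsUniformlyGeometricallyErgodic Q π τ) :
    HasSum (fun k : ℕ => 2 * (1 / 4 : ℝ) ^ (k / τ)) (8 / 3 * τ) := by
  have h_const : 2 * ((1 - 1 / 4 : ℝ)⁻¹ * τ) = 8 / 3 * τ := by ring
  rw [← h_const]
  exact (hasSum_pow_div (by norm_num) (by norm_num) hQ.mixingTime_pos).mul_left 2

lemma abs_kernelAvg_pow_centered_le (hQ : IsUniformlyGeometricallyErgodic Q π τ)
    (hf : Measurable f) (hf₁ : ∀ z, |f z| ≤ 1) (k : ℕ) (z : Z) :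
    |kernelAvg (Q ^ k) (centered π f) z| ≤ 2 * (1 / 4) ^ (k / τ) := by
  have h_center := kernelAvg_mul_sub_const (κ := Q ^ k) (.of_abs_le hf hf₁) 1 (∫ x, f x ∂π) z
  simp only [one_mul] at h_center
  simpa only [← h_center, mul_one] using! hQ.abs_kernelAvg_pow_sub_le hf hf₁ k z

lemma summable_autocov (hQ : IsUniformlyGeometricallyErgodic Q π τ) (hf : Measurable f)
    (hf₁ : ∀ z, |f z| ≤ 1) : Summable (autocov Q π f) :=
  have hf' : BoundedMeasurable mZ (centered π f) := (BoundedMeasurable.of_abs_le hf hf₁).centered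
  (hasSum_integral_mul_potential π hf' hf' hQ.hasSum_rate.summable
    (hQ.abs_kernelAvg_pow_centered_le hf hf₁)).summable

theorem asymptoticVariance_eq_integral_stepVar (hQ : IsUniformlyGeometricallyErgodic Q π τ)
    (hf : Measurable f) (hf₁ : ∀ z, |f z| ≤ 1) :
    asymptoticVariance Q π f = ∫ z, stepVar Q (potential Q (centered π f)) z ∂π := by
  have hc : BoundedMeasurable mZ (centered π f) := (BoundedMeasurable.of_abs_le hf hf₁).centered
  have h_rate := hQ.abs_kernelAvg_pow_centered_le hf hf₁
  have h_series := hasSum_integral_mul_potential π hc hc hQ.hasSum_rate.summable h_rate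
  have hg := hc.potential hQ.hasSum_rate h_rate
  have h_poisson := potential_sub_kernelAvg hc hQ.hasSum_rate.summable h_rate
  set g := potential Q (centered π f)
  have h_step : ∫ z, stepVar Q g z ∂π
      = 2 * ∫ z, centered π f z * g z ∂π - ∫ z, centered π f z ^ 2 ∂π := calc
    ∫ z, stepVar Q g z ∂π = ∫ z, (g z ^ 2 - kernelAvg Q g z ^ 2) ∂π := by
        simp only [stepVar_eq hg]
        rw [integral_sub ((hg.sq.kernelAvg Q).integrable _) ((hg.kernelAvg Q).sq.integrable _),
          integral_kernelAvg_of_invariant hQ.invariant hg.sq,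
          integral_sub (hg.sq.integrable _) ((hg.kernelAvg Q).sq.integrable _)]
    _ = ∫ z, (2 * (centered π f z * g z) - centered π f z ^ 2) ∂π := by
        congr 1 with z
        rw [← h_poisson z]
        ring
    _ = _ := by
        rw [integral_sub (((hc.mul hg).const_mul 2).integrable _) (hc.sq.integrable _),
          integral_const_mul]
  have h_autocov : ∫ z, centered π f z * g z ∂π
      = ∫ z, centered π f z ^ 2 ∂π + ∑' l : ℕ, autocov Q π f (l + 1) := by
    rw [← h_series.tsum_eq, h_series.summable.tsum_eq_zero_add,
      kernelAvg_pow_zero hc.measurable]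
    simp only [pow_two]
    rfl
  rw [h_step, h_autocov, asymptoticVariance]
  ring

lemma asymptoticVariance_nonneg (hQ : IsUniformlyGeometricallyErgodic Q π τ) (hf : Measurable f)
    (hf₁ : ∀ z, |f z| ≤ 1) : 0 ≤ asymptoticVariance Q π f := by
  rw [hQ.asymptoticVariance_eq_integral_stepVar hf hf₁]
  exact integral_nonneg fun _ => variance_nonneg _ _

end AsymptoticVariance

section ExponentialMoment

lemma abs_potential_centered_le (hQ : IsUniformlyGeometricallyErgodic Q π τ)
    (hf : Measurable f) (hf₁ : ∀ z, |f z| ≤ 1) (z : Z) :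
    |potential Q (centered π f) z| ≤ 8 / 3 * τ :=
  abs_potential_le hQ.hasSum_rate (hQ.abs_kernelAvg_pow_centered_le hf hf₁) z

lemma boundedMeasurable_potential (hQ : IsUniformlyGeometricallyErgodic Q π τ)
    (hf : Measurable f) (hf₁ : ∀ z, |f z| ≤ 1) :
    BoundedMeasurable mZ (potential Q (centered π f)) :=
  (BoundedMeasurable.of_abs_le hf hf₁).centered.potential hQ.hasSum_rate
    (hQ.abs_kernelAvg_pow_centered_le hf hf₁)

lemma abs_martingaleBlock_le (hQ : IsUniformlyGeometricallyErgodic Q π τ)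
    (hf : Measurable f) (hf₁ : ∀ z, |f z| ≤ 1) (k : ℕ) (ω : ℕ → Z) :
    |martingaleBlock Q (potential Q (centered π f)) k τ ω| ≤ 8 * τ := by
  have hc : BoundedMeasurable mZ (centered π f) := (BoundedMeasurable.of_abs_le hf hf₁).centered
  have hg := hQ.abs_potential_centered_le hf hf₁
  have h_sum : |centeredSum π f τ fun j => ω (k + j)| ≤ 2 * τ := abs_centeredSum_le hf₁ _ _
  simp only [martingaleBlock_eq_sum, potential_sub_kernelAvg hc hQ.hasSum_rate.summable
    (hQ.abs_kernelAvg_pow_centered_le hf hf₁)]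
  refine (abs_add_le _ _).trans ((add_le_add h_sum (abs_sub _ _)).trans ?_)
  linarith [hg (ω (k + τ)), hg (ω k)]

lemma abs_kernelAvg_pow_blockVar_le (hQ : IsUniformlyGeometricallyErgodic Q π τ)
    (hf : Measurable f) (hf₁ : ∀ z, |f z| ≤ 1) (k : ℕ) (z : Z) :
    |kernelAvg ((Q ^ τ) ^ k) (fun z => 2 * (blockVar Q (potential Q (centered π f)) τ z
      - ∫ x, blockVar Q (potential Q (centered π f)) τ x ∂π)) z| ≤ 256 * τ ^ 2 * (1 / 4) ^ k := by
  have hv := (hQ.boundedMeasurable_potential hf hf₁).blockVar (Q := Q) τ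
  have hv_le := abs_blockVar_le (hQ.boundedMeasurable_potential hf hf₁)
    (hQ.abs_martingaleBlock_le hf hf₁ 0)
  have h_mix := hQ.abs_kernelAvg_pow_sub_le hv.measurable hv_le (τ * k) z
  rw [Nat.mul_div_cancel_left _ hQ.mixingTime_pos] at h_mix
  rw [← pow_mul, kernelAvg_mul_sub_const hv, abs_mul, abs_two]
  linarith

lemma abs_compensator_le (hQ : IsUniformlyGeometricallyErgodic Q π τ) (hf : Measurable f)
    (hf₁ : ∀ z, |f z| ≤ 1) (z : Z) : |compensator Q π f τ z| ≤ 1024 / 3 * τ ^ 2 :=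
  (abs_potential_le (hasSum_mul_one_fourth_pow _) (hQ.abs_kernelAvg_pow_blockVar_le hf hf₁)
    z).trans_eq (by ring)

lemma measurable_compensator (hQ : IsUniformlyGeometricallyErgodic Q π τ) (hf : Measurable f)
    (hf₁ : ∀ z, |f z| ≤ 1) : Measurable (compensator Q π f τ) :=
  have hv := (hQ.boundedMeasurable_potential hf hf₁).blockVar (Q := Q) τ
  (((hv.sub (.const _)).const_mul 2).potential (hasSum_mul_one_fourth_pow _)
    (hQ.abs_kernelAvg_pow_blockVar_le hf hf₁)).measurable

lemma compensator_sub_kernelAvg (hQ : IsUniformlyGeometricallyErgodic Q π τ) (hf : Measurable f)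
    (hf₁ : ∀ z, |f z| ≤ 1) (z : Z) :
    compensator Q π f τ z - kernelAvg (Q ^ τ) (compensator Q π f τ) z
      = 2 * (blockVar Q (potential Q (centered π f)) τ z - τ * asymptoticVariance Q π f) := by
  have hg := hQ.boundedMeasurable_potential hf hf₁
  rw [hQ.asymptoticVariance_eq_integral_stepVar hf hf₁, ← integral_blockVar hQ.invariant hg]
  exact potential_sub_kernelAvg (((hg.blockVar τ).sub (.const _)).const_mul 2)
    (hasSum_mul_one_fourth_pow _).summable (hQ.abs_kernelAvg_pow_blockVar_le hf hf₁) z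

theorem integral_exp_centeredSum_mul_le (hQ : IsUniformlyGeometricallyErgodic Q π τ)
    (ξ : Measure Z) [IsProbabilityMeasure ξ] (hf : Measurable f) (hf₁ : ∀ z, |f z| ≤ 1) {θ : ℝ}
    (hθ : |θ| * τ ≤ 1 / 40) (m : ℕ) :
    ∫ ω, Real.exp (θ * centeredSum π f (m * τ) ω) ∂(chainLaw Q ξ)
      ≤ Real.exp (2 * (m * τ) * θ ^ 2 * asymptoticVariance Q π f
        + 1000000 * (m * τ) * τ ^ 3 * θ ^ 4 + 19 / 20) := by
  have hc : BoundedMeasurable mZ (centered π f) := (BoundedMeasurable.of_abs_le hf hf₁).centered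
  have hθτ_sq : θ ^ 2 * τ ^ 2 ≤ 1 / 1600 := by
    calc θ ^ 2 * (τ : ℝ) ^ 2 = (|θ| * τ) ^ 2 := by rw [mul_pow, sq_abs]
      _ ≤ (1 / 40) ^ 2 := by gcongr
      _ = 1 / 1600 := by norm_num
  have h_moment := integral_exp_sum_le ξ (hQ.boundedMeasurable_potential hf hf₁).measurable
    (hQ.abs_potential_centered_le hf hf₁) (hQ.measurable_compensator hf hf₁)
    (hQ.abs_compensator_le hf hf₁) (hQ.abs_martingaleBlock_le hf hf₁)
    (hQ.compensator_sub_kernelAvg hf hf₁) (θ := θ) (by linarith) m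
  simp only [potential_sub_kernelAvg hc hQ.hasSum_rate.summable
    (hQ.abs_kernelAvg_pow_centered_le hf hf₁)] at h_moment
  refine h_moment.trans (Real.exp_le_exp.2 ?_)
  have h_quartic : 0 ≤ m * θ ^ 4 * (τ : ℝ) ^ 4 := by positivity
  linarith

theorem integral_exp_centeredSum_le (hQ : IsUniformlyGeometricallyErgodic Q π τ)
    (ξ : Measure Z) [IsProbabilityMeasure ξ] (hf : Measurable f) (hf₁ : ∀ z, |f z| ≤ 1) {θ : ℝ}
    (hθ : |θ| * τ ≤ 1 / 40) (n : ℕ) :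
    ∫ ω, Real.exp (θ * centeredSum π f n ω) ∂(chainLaw Q ξ)
      ≤ Real.exp (2 * n * θ ^ 2 * asymptoticVariance Q π f
        + 1000000 * n * τ ^ 3 * θ ^ 4 + 1) := by
  have hS : ∀ k, BoundedMeasurable MeasurableSpace.pi fun ω =>
      Real.exp (θ * centeredSum π f k ω) := fun k =>
    (((BoundedMeasurable.of_abs_le hf hf₁).centeredSum k).const_mul θ).exp
  have h_rem : ((n % τ : ℕ) : ℝ) ≤ τ := by exact_mod_cast (Nat.mod_lt n hQ.mixingTime_pos).le
  have h_blocks : ((n / τ : ℕ) : ℝ) * τ ≤ n := by exact_mod_cast Nat.div_mul_le_self n τ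
  have h_split : ∀ ω, Real.exp (θ * centeredSum π f n ω)
      ≤ Real.exp (1 / 20) * Real.exp (θ * centeredSum π f (n / τ * τ) ω) := by
    intro ω
    rw [← Real.exp_add, Real.exp_le_exp]
    conv_lhs => rw [← Nat.div_add_mod' n τ, centeredSum_add]
    have h_tail := abs_centeredSum_le (π := π) hf₁ (n % τ) fun i => ω (i + n / τ * τ)
    have h_small : θ * centeredSum π f (n % τ) (fun i => ω (i + n / τ * τ)) ≤ 1 / 20 := calc
      _ ≤ |θ| * |centeredSum π f (n % τ) fun i => ω (i + n / τ * τ)| :=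
          (le_abs_self _).trans_eq (abs_mul _ _)
      _ ≤ |θ| * (2 * τ) := by gcongr; linarith
      _ ≤ 1 / 20 := by linarith
    linarith
  have hσ := hQ.asymptoticVariance_nonneg hf hf₁
  calc ∫ ω, Real.exp (θ * centeredSum π f n ω) ∂(chainLaw Q ξ)
    _ ≤ Real.exp (1 / 20) * ∫ ω, Real.exp (θ * centeredSum π f (n / τ * τ) ω) ∂(chainLaw Q ξ) := by
        rw [← integral_const_mul]
        exact integral_mono ((hS n).integrable _) (((hS _).const_mul _).integrable _) h_split
    _ ≤ Real.exp (1 / 20) * Real.exp (2 * n * θ ^ 2 * asymptoticVariance Q π f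
          + 1000000 * n * τ ^ 3 * θ ^ 4 + 19 / 20) := by
        gcongr
        refine (hQ.integral_exp_centeredSum_mul_le ξ hf hf₁ hθ (n / τ)).trans ?_
        gcongr
    _ = _ := by
        rw [← Real.exp_add]
        ring_nf

end ExponentialMoment

end IsUniformlyGeometricallyErgodic

end CenteredSum

section Moments

lemma rpow_le_mul_exp {p θ x : ℝ} (hp : 0 < p) (hθ : 0 < θ) (hx : 0 ≤ x) :
    x ^ p ≤ (p / θ * Real.exp (-1)) ^ p * Real.exp (θ * x) := by
  have h_linear : x ≤ p / θ * Real.exp (-1) * Real.exp (θ * x / p) := calc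
    x = p / θ * (θ * x / p - 1 + 1) := by field_simp; ring
    _ ≤ p / θ * Real.exp (θ * x / p - 1) := by
        gcongr
        exact Real.add_one_le_exp _
    _ = p / θ * Real.exp (-1) * Real.exp (θ * x / p) := by
        rw [mul_assoc, ← Real.exp_add, neg_add_eq_sub]
  calc x ^ p ≤ (p / θ * Real.exp (-1) * Real.exp (θ * x / p)) ^ p := by gcongr
    _ = (p / θ * Real.exp (-1)) ^ p * Real.exp (θ * x) := by
        rw [Real.mul_rpow (by positivity) (by positivity), ← Real.exp_mul,
          div_mul_cancel₀ _ hp.ne']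

lemma rpow_integral_abs_rpow_le {X : Type*} [MeasurableSpace X] (μ : Measure X)
    [IsFiniteMeasure μ] {Y : X → ℝ} (hY : BoundedMeasurable inferInstance Y) {p θ K : ℝ}
    (hp : 0 < p) (hθ : 0 < θ) (h_pos : ∫ x, Real.exp (θ * Y x) ∂μ ≤ Real.exp K)
    (h_neg : ∫ x, Real.exp (-θ * Y x) ∂μ ≤ Real.exp K) :
    (∫ x, |Y x| ^ p ∂μ) ^ (1 / p) ≤ p / θ * Real.exp ((K + 1) / p - 1) := by
  have h_exp : ∀ s : ℝ, Integrable (fun x => Real.exp (s * Y x)) μ := fun s =>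
    (hY.const_mul s).exp.integrable μ
  have h_point : ∀ x, |Y x| ^ p ≤ (p / θ * Real.exp (-1)) ^ p *
      (Real.exp (θ * Y x) + Real.exp (-θ * Y x)) := by
    intro x
    refine (rpow_le_mul_exp hp hθ (abs_nonneg (Y x))).trans ?_
    gcongr
    rcases abs_cases (Y x) with ⟨h, _⟩ | ⟨h, _⟩
    · rw [h]
      exact le_add_of_nonneg_right (Real.exp_pos _).le
    · rw [h, mul_neg, ← neg_mul]
      exact le_add_of_nonneg_left (Real.exp_pos _).le
  have h_two : (2 : ℝ) ≤ Real.exp 1 := by linarith [Real.add_one_le_exp (1 : ℝ)]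
  have h_moment : ∫ x, |Y x| ^ p ∂μ ≤ (p / θ * Real.exp ((K + 1) / p - 1)) ^ p := calc
    ∫ x, |Y x| ^ p ∂μ ≤ ∫ x, (p / θ * Real.exp (-1)) ^ p *
          (Real.exp (θ * Y x) + Real.exp (-θ * Y x)) ∂μ :=
        integral_mono ((hY.abs_rpow hp.le).integrable μ)
          (((h_exp θ).add (h_exp (-θ))).const_mul _) h_point
    _ ≤ (p / θ * Real.exp (-1)) ^ p * (Real.exp 1 * Real.exp K) := by
        rw [integral_const_mul, integral_add (h_exp θ) (h_exp (-θ))]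
        gcongr
        nlinarith [Real.exp_pos K]
    _ = (p / θ * Real.exp ((K + 1) / p - 1)) ^ p := by
        rw [← Real.exp_add, add_comm 1 K, sub_eq_neg_add ((K + 1) / p), Real.exp_add (-1),
          ← mul_assoc, Real.mul_rpow (y := Real.exp ((K + 1) / p)) (by positivity)
            (by positivity), ← Real.exp_mul ((K + 1) / p), div_mul_cancel₀ _ hp.ne']
  calc (∫ x, |Y x| ^ p ∂μ) ^ (1 / p)
    _ ≤ ((p / θ * Real.exp ((K + 1) / p - 1)) ^ p) ^ (1 / p) := by
        gcongr
    _ = p / θ * Real.exp ((K + 1) / p - 1) := by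
        rw [one_div, Real.rpow_rpow_inv (by positivity) hp.ne']

end Moments

section Constants

lemma exp_four_le : Real.exp 4 ≤ 55 := by
  calc Real.exp 4 = Real.exp 1 ^ 4 := by rw [← Real.exp_nat_mul]; norm_num
    _ ≤ 2.7182818286 ^ 4 := by
        gcongr
        exact Real.exp_one_lt_d9.le
    _ ≤ 55 := by norm_num

lemma le_CRm1 : 163 ≤ CRm1 := by
  rw [CRm1]
  linarith [Real.exp_one_gt_d9]

lemma le_D1 : 1760 ≤ D1 := by
  have h_sqrt : 5 / 2 ≤ Real.sqrt (19 / 3) := Real.le_sqrt_of_sq_le (by norm_num)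
  calc (1760 : ℝ) ≤ 16 / 3 * (5 / 2) * 163 := by norm_num
    _ ≤ D1 := by
        rw [D1]
        gcongr
        exact le_CRm1

lemma le_D2 : 1000000 ≤ D2 := by
  have h_sqrt : 7 ≤ Real.sqrt 60 := Real.le_sqrt_of_sq_le (by norm_num)
  calc (1000000 : ℝ) ≤ 64 / 3 * (7 * 163 ^ 2 + 60) := by norm_num
    _ ≤ D2 := by
        rw [D2, CRm2]
        gcongr
        exact le_CRm1

lemma rpow_one_div_two_sq {x : ℝ} (hx : 0 ≤ x) : (x ^ (1 / 2 : ℝ)) ^ 2 = x := by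
  rw [← Real.sqrt_eq_rpow, Real.sq_sqrt hx]

lemma one_le_logb_two_mul {p : ℝ} (hp : 1 ≤ p) : 1 ≤ Real.logb 2 (2 * p) := by
  rw [Real.le_logb_iff_rpow_le (by norm_num) (by positivity), Real.rpow_one]
  linarith

lemma mul_add_le_rosenthal_bound {p y s v t : ℝ} (hp : 1 ≤ p) (hy : 0 ≤ y) (hs : 0 ≤ s)
    (hv : 0 ≤ v) (ht : 0 ≤ t) :
    55 * p * (y * s / p ^ (1 / 2 : ℝ) + 32 * v + 40 * t) ≤
      CRm1 * Real.sqrt 2 * p ^ (1 / 2 : ℝ) * y * s + D1 * v * p * Real.logb 2 (2 * p)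
        + D2 * t * p * Real.logb 2 (2 * p) := by
  have hp₀ : 0 < p := by linarith
  have h_log := one_le_logb_two_mul hp
  have hx : (p ^ (1 / 2 : ℝ)) ^ 2 = p := rpow_one_div_two_sq hp₀.le
  set l := Real.logb 2 (2 * p)
  set x := p ^ (1 / 2 : ℝ)
  have hx₀ : 0 < x := Real.rpow_pos_of_pos hp₀ _
  have hC : 55 ≤ CRm1 * Real.sqrt 2 := by
    nlinarith [le_CRm1, Real.one_le_sqrt.2 (one_le_two (α := ℝ))]
  have hD₁ : 1760 * 1 ≤ D1 * l := mul_le_mul le_D1 h_log zero_le_one (by linarith [le_D1])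
  have hD₂ : 2200 * 1 ≤ D2 * l :=
    mul_le_mul (by linarith [le_D2]) h_log zero_le_one (by linarith [le_D2])
  calc 55 * p * (y * s / x + 32 * v + 40 * t)
    _ = 55 * (x * y * s) + 1760 * 1 * (v * p) + 2200 * 1 * (t * p) := by
        rw [← hx]
        field_simp
        ring
    _ ≤ CRm1 * Real.sqrt 2 * (x * y * s) + D1 * l * (v * p) + D2 * l * (t * p) := by gcongr
    _ = CRm1 * Real.sqrt 2 * x * y * s + D1 * v * p * l + D2 * t * p * l := by ring

end Constants

section Rosenthal

variable {Z : Type*} [mZ : MeasurableSpace Z] {Q : Kernel Z Z} [IsMarkovKernel Q]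
  {π : Measure Z} [IsProbabilityMeasure π] {τ : ℕ} {f : Z → ℝ} {p : ℝ}

namespace IsUniformlyGeometricallyErgodic

lemma momentNorm_le (hQ : IsUniformlyGeometricallyErgodic Q π τ)
    (ξ : Measure Z) [IsProbabilityMeasure ξ] (hf : Measurable f) (hf₁ : ∀ z, |f z| ≤ 1)
    (hp : 1 ≤ p) {n : ℕ} {a b : ℝ} (ha : 0 ≤ a) (hb : 0 ≤ b)
    (ha_var : n * asymptoticVariance Q π f ≤ p * a ^ 2)
    (hb_rem : 1000000 * n * τ ^ 3 ≤ b ^ 4) :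
    momentNorm Q ξ π f n p ≤ 55 * p * (a + b + 40 * τ) := by
  have hτ : (0 : ℝ) < τ := by exact_mod_cast hQ.mixingTime_pos
  have hp₀ : 0 < p := by linarith
  set s := a + b + 40 * τ
  have hs₀ : 0 < s := by positivity
  set θ := s⁻¹
  have hθ₀ : 0 < θ := inv_pos.2 hs₀
  have h_small : ∀ {x : ℝ}, x ≤ s → θ * x ≤ 1 := fun {x} hx => by
    rw [← inv_mul_cancel₀ hs₀.ne']
    exact mul_le_mul_of_nonneg_left hx hθ₀.le
  have hθτ : θ * τ ≤ 1 / 40 := by linarith [h_small (x := 40 * τ) (by linarith)]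
  have h_exponent : 2 * n * θ ^ 2 * asymptoticVariance Q π f + 1000000 * n * τ ^ 3 * θ ^ 4 + 1
      ≤ 5 * p - 1 := by
    have h_var : θ ^ 2 * (n * asymptoticVariance Q π f) ≤ p := calc
      _ ≤ θ ^ 2 * (p * a ^ 2) := by gcongr
      _ = p * (θ * a) ^ 2 := by ring
      _ ≤ p * 1 ^ 2 := by gcongr; exact h_small (by linarith)
      _ = p := by ring
    have h_rem : θ ^ 4 * (1000000 * n * τ ^ 3) ≤ 1 := calc
      _ ≤ θ ^ 4 * b ^ 4 := by gcongr
      _ = (θ * b) ^ 4 := by ring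
      _ ≤ 1 := pow_le_one₀ (by positivity) (h_small (by linarith))
    linarith
  have h_exp : ∀ t : ℝ, |t| = θ →
      ∫ ω, Real.exp (t * centeredSum π f n ω) ∂(chainLaw Q ξ) ≤ Real.exp (5 * p - 1) := by
    intro t ht
    refine (hQ.integral_exp_centeredSum_le ξ hf hf₁ (by rwa [ht]) n).trans ?_
    rwa [Real.exp_le_exp, ← sq_abs, ← Even.pow_abs (n := 4) (by decide) t, ht]
  calc momentNorm Q ξ π f n p ≤ p / θ * Real.exp ((5 * p - 1 + 1) / p - 1) :=
        rpow_integral_abs_rpow_le _ ((BoundedMeasurable.of_abs_le hf hf₁).centeredSum n) hp₀ hθ₀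
          (h_exp θ (abs_of_pos hθ₀)) (h_exp (-θ) (by rw [abs_neg, abs_of_pos hθ₀]))
    _ = p * s * Real.exp 4 := by
        rw [sub_add_cancel, mul_div_cancel_right₀ _ hp₀.ne', div_inv_eq_mul]
        norm_num
    _ ≤ 55 * p * s := by nlinarith [exp_four_le, mul_pos hp₀ hs₀]

theorem momentNorm_le_rosenthal (hQ : IsUniformlyGeometricallyErgodic Q π τ)
    (ξ : Measure Z) [IsProbabilityMeasure ξ] (hf : Measurable f) (hf₁ : ∀ z, |f z| ≤ 1)
    (hp : 1 ≤ p) (n : ℕ) :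
    momentNorm Q ξ π f n p ≤
      CRm1 * Real.sqrt 2 * p ^ (1 / 2 : ℝ) * (n : ℝ) ^ (1 / 2 : ℝ) * asymptoticStd Q π f
        + D1 * (n : ℝ) ^ (1 / 4 : ℝ) * (τ : ℝ) ^ (3 / 4 : ℝ) * p * Real.logb 2 (2 * p)
        + D2 * τ * p * Real.logb 2 (2 * p) := by
  have hp₀ : 0 < p := by linarith
  have hσ : asymptoticStd Q π f ^ 2 = asymptoticVariance Q π f :=
    Real.sq_sqrt (hQ.asymptoticVariance_nonneg hf hf₁)
  have hσ₀ : 0 ≤ asymptoticStd Q π f := Real.sqrt_nonneg _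
  have h_root_n : ((n : ℝ) ^ (1 / 4 : ℝ)) ^ 4 = n := by
    rw [← Real.rpow_mul_natCast n.cast_nonneg]; norm_num
  have h_root_τ : ((τ : ℝ) ^ (3 / 4 : ℝ)) ^ 4 = (τ : ℝ) ^ 3 := by
    rw [← Real.rpow_mul_natCast τ.cast_nonneg]; norm_num
  have h_nonneg : 0 ≤ (n : ℝ) * τ ^ 3 := by positivity
  set v := (n : ℝ) ^ (1 / 4 : ℝ) * (τ : ℝ) ^ (3 / 4 : ℝ) with hv
  calc momentNorm Q ξ π f n p
    _ ≤ 55 * p * ((n : ℝ) ^ (1 / 2 : ℝ) * asymptoticStd Q π f / p ^ (1 / 2 : ℝ) + 32 * v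
          + 40 * τ) := by
        refine hQ.momentNorm_le ξ hf hf₁ hp (by positivity) (by positivity) ?_ ?_
        · rw [div_pow, mul_pow, rpow_one_div_two_sq hp₀.le, rpow_one_div_two_sq n.cast_nonneg, hσ,
            mul_div_cancel₀ _ hp₀.ne']
        · rw [mul_pow, hv, mul_pow, h_root_n, h_root_τ]
          linarith
    _ ≤ _ := mul_add_le_rosenthal_bound hp (by positivity) hσ₀ (by positivity) τ.cast_nonneg
    _ = _ := by rw [hv, ← mul_assoc D1]

end IsUniformlyGeometricallyErgodic

end Rosenthal

section CommonPart

variable {Z : Type*} [mZ : MeasurableSpace Z]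

lemma sub_inf_apply_univ_le {μ ν : Measure Z} [IsFiniteMeasure μ] {ε : ENNReal}
    (h : ∀ A, MeasurableSet A → μ A ≤ ν A + ε) : (μ - μ ⊓ ν) Set.univ ≤ ε := by
  have : IsFiniteMeasure (μ ⊓ ν) := isFiniteMeasure_of_le μ inf_le_left
  have h_inf : μ Set.univ - ε ≤ (μ ⊓ ν) Set.univ := by
    rw [Measure.inf_apply .univ]
    refine le_sInf ?_
    rintro _ ⟨t, rfl⟩
    set s := toMeasurable ν tᶜ
    have hs : MeasurableSet s := measurableSet_toMeasurable ν tᶜ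
    have hst : sᶜ ⊆ t := Set.compl_subset_comm.1 (subset_toMeasurable ν tᶜ)
    rw [Set.inter_univ, Set.inter_univ, tsub_le_iff_right]
    calc μ Set.univ = μ sᶜ + μ s := by rw [add_comm, measure_add_measure_compl hs]
      _ ≤ μ t + (ν s + ε) := add_le_add (measure_mono hst) (h s hs)
      _ = μ t + ν tᶜ + ε := by rw [measure_toMeasurable, add_assoc]
  rw [Measure.sub_apply .univ inf_le_left]
  exact tsub_le_iff_tsub_le.1 h_inf

lemma exists_eq_add_eq_add {μ ν : Measure Z} [IsFiniteMeasure μ] [IsFiniteMeasure ν]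
    (h_mass : μ Set.univ = ν Set.univ) {ε : ENNReal}
    (h : ∀ A, MeasurableSet A → μ A ≤ ν A + ε) :
    ∃ α η η' : Measure Z, IsFiniteMeasure α ∧ IsFiniteMeasure η ∧ IsFiniteMeasure η' ∧
      μ = α + η ∧ ν = α + η' ∧ η Set.univ = η' Set.univ ∧ η Set.univ ≤ ε := by
  have hα : IsFiniteMeasure (μ ⊓ ν) := isFiniteMeasure_of_le μ inf_le_left
  have hμ : μ = μ ⊓ ν + (μ - μ ⊓ ν) := by
    rw [add_comm, Measure.sub_add_cancel_of_le inf_le_left]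
  have hν : ν = μ ⊓ ν + (ν - μ ⊓ ν) := by
    rw [add_comm, Measure.sub_add_cancel_of_le inf_le_right]
  refine ⟨μ ⊓ ν, μ - μ ⊓ ν, ν - μ ⊓ ν, hα, inferInstance, inferInstance, hμ, hν, ?_,
    sub_inf_apply_univ_le h⟩
  rw [Measure.sub_apply .univ inf_le_left, Measure.sub_apply .univ inf_le_right, h_mass]

lemma comp_apply_le_comp_apply_add {κ : Kernel Z Z} {ε : ENNReal}
    (h_mix : ∀ z z' A, MeasurableSet A → κ z A ≤ κ z' A + ε) {μ ν : Measure Z}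
    (h_mass : μ Set.univ = ν Set.univ) {A : Set Z} (hA : MeasurableSet A) :
    (κ ∘ₘ μ) A ≤ (κ ∘ₘ ν) A + ε * μ Set.univ := by
  rw [Measure.bind_apply hA (by fun_prop), Measure.bind_apply hA (by fun_prop)]
  calc ∫⁻ z, κ z A ∂μ ≤ ∫⁻ _, ((⨅ z', κ z' A) + ε) ∂μ := by
        refine lintegral_mono fun z => ?_
        rw [ENNReal.iInf_add]
        exact le_iInf fun z' => h_mix z z' A hA
    _ = ∫⁻ _, (⨅ z', κ z' A) ∂ν + ε * μ Set.univ := by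
        rw [lintegral_const, lintegral_const, add_mul, h_mass]
    _ ≤ ∫⁻ z, κ z A ∂ν + ε * μ Set.univ := by
        gcongr with z
        exact iInf_le _ z

lemma IsUniformlyGeometricallyErgodic.pow_apply_le {Q : Kernel Z Z} [IsMarkovKernel Q]
    {π : Measure Z} [IsProbabilityMeasure π] {τ : ℕ} (hQ : IsUniformlyGeometricallyErgodic Q π τ)
    (z z' : Z) (A : Set Z) (hA : MeasurableSet A) :
    (Q ^ (2 * τ)) z A ≤ (Q ^ (2 * τ)) z' A + 1 / 4 := by
  have h_indicator : ∀ x, |A.indicator (1 : Z → ℝ) x| ≤ 1 := fun x => by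
    by_cases hx : x ∈ A <;> simp [hx]
  have h_avg : ∀ x, |((Q ^ (2 * τ)) x).real A - π.real A| ≤ 1 / 8 := fun x => by
    have h := hQ.abs_kernelAvg_pow_sub_le (measurable_one.indicator hA) h_indicator (2 * τ) x
    rw [kernelAvg, integral_indicator_one hA, integral_indicator_one hA,
      Nat.mul_div_cancel _ hQ.mixingTime_pos] at h
    exact h.trans_eq (by norm_num)
  have h_real : ((Q ^ (2 * τ)) z).real A ≤ ((Q ^ (2 * τ)) z').real A + 1 / 4 := by
    linarith [(abs_le.1 (h_avg z)).2, (abs_le.1 (h_avg z')).1]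
  have h_ofReal := ENNReal.ofReal_le_ofReal h_real
  rw [ENNReal.ofReal_add measureReal_nonneg (by norm_num), ofReal_measureReal, ofReal_measureReal,
    ENNReal.ofReal_div_of_pos (by norm_num)] at h_ofReal
  simpa using h_ofReal

end CommonPart

section WeightedPower

lemma add_rpow_le_weighted {p l x y : ℝ} (hp : 1 ≤ p) (hl : 0 < l) (hl₁ : l < 1) (hx : 0 ≤ x)
    (hy : 0 ≤ y) : (x + y) ^ p ≤ l ^ (1 - p) * x ^ p + (1 - l) ^ (1 - p) * y ^ p := by
  have h_scale : ∀ {t w : ℝ}, 0 < t → 0 ≤ w → t * (w / t) ^ p = t ^ (1 - p) * w ^ p := by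
    intro t w ht hw
    rw [Real.div_rpow hw ht.le, Real.rpow_sub ht, Real.rpow_one]
    ring
  have hl' : 0 < 1 - l := sub_pos.2 hl₁
  have h_convex := (convexOn_rpow hp).2 (x := x / l) (y := y / (1 - l))
    (Set.mem_Ici.2 (by positivity)) (Set.mem_Ici.2 (by positivity)) hl.le hl'.le (by ring)
  simpa only [smul_eq_mul, mul_div_cancel₀ _ hl.ne', mul_div_cancel₀ _ hl'.ne', h_scale hl hx,
    h_scale hl' hy] using h_convex

lemma rpow_one_div_le_add {p X Y b : ℝ} (hp : 1 ≤ p) (hX : 0 ≤ X) (hY : 0 ≤ Y) (hb : 0 < b)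
    (h : ∀ l : ℝ, 0 < l → l < 1 → X ≤ l ^ (1 - p) * Y + (1 - l) ^ (1 - p) * b ^ p) :
    X ^ (1 / p) ≤ Y ^ (1 / p) + b := by
  have hp₀ : 0 < p := by linarith
  have : 0 ≤ Y ^ (1 / p) := Real.rpow_nonneg hY _
  refine le_of_forall_pos_le_add fun ε hε => ?_
  set N := Y ^ (1 / p) + ε with hN
  have hN₀ : 0 < N := by positivity
  have hYN : Y ≤ N ^ p := by
    rw [← Real.rpow_inv_le_iff_of_pos hY hN₀.le hp₀, ← one_div]
    exact le_add_of_nonneg_right hε.le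
  have h_optimal : ∀ {t : ℝ}, 0 < t →
      (t / (N + b)) ^ (1 - p) * t ^ p = t * (N + b) ^ (p - 1) := by
    intro t ht
    rw [Real.div_rpow ht.le (by positivity), div_mul_eq_mul_div, ← Real.rpow_add ht,
      sub_add_cancel, Real.rpow_one, div_eq_mul_inv, ← Real.rpow_neg (by positivity), neg_sub]
  have h_compl : 1 - N / (N + b) = b / (N + b) := by field_simp; ring
  have h_add : X ≤ (N + b) ^ p := calc
    X ≤ (N / (N + b)) ^ (1 - p) * Y + (1 - N / (N + b)) ^ (1 - p) * b ^ p :=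
        h _ (by positivity) ((div_lt_one (by positivity)).2 (lt_add_of_pos_right N hb))
    _ ≤ (N / (N + b)) ^ (1 - p) * N ^ p + (b / (N + b)) ^ (1 - p) * b ^ p := by
        rw [h_compl]
        gcongr
    _ = (N + b) ^ p := by
        rw [h_optimal hN₀, h_optimal hb, ← add_mul, Real.rpow_sub_one (by positivity),
          mul_div_cancel₀ _ (by positivity)]
  calc X ^ (1 / p) ≤ N + b := by
        rwa [one_div, Real.rpow_inv_le_iff_of_pos hX (by positivity) hp₀]
    _ = Y ^ (1 / p) + b + ε := by rw [hN]; ring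

end WeightedPower

section MomentComparison

variable {Z : Type*} [mZ : MeasurableSpace Z] (Q : Kernel Z Z) [IsMarkovKernel Q]
  (μ ν π : Measure Z) (f : Z → ℝ) (p c l : ℝ) (k n : ℕ)

/-- The `p`-th moment of `|∑_{i < n} (f(Z_i) - π(f))| + c` under the chain started from `μ`; the
surplus `c` bounds the part of the sum that has been dropped. -/
noncomputable def upperMoment : ENNReal :=
  ∫⁻ ω, ENNReal.ofReal ((|centeredSum π f n ω| + c) ^ p) ∂(chainLaw Q μ)

/-- The `p`-th moment of the positive part of `|∑_{i < n} (f(Z_i) - π(f))| - c` under the chain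
started from `μ`. -/
noncomputable def lowerMoment : ENNReal :=
  ∫⁻ ω, ENNReal.ofReal (max (|centeredSum π f n ω| - c) 0 ^ p) ∂(chainLaw Q μ)

/-- The price, per unit of mass, of comparing two initial laws when the sums have already been
changed by at most `c` and new matchings take place every `k` steps. -/
noncomputable def couplingCost : ℝ :=
  4 * (4 * k * p) ^ p * Real.exp (c / (2 * k))

lemma upperMoment_add : upperMoment Q (μ + ν) π f p c n =
    upperMoment Q μ π f p c n + upperMoment Q ν π f p c n := by
  simp only [upperMoment, chainLaw_add, lintegral_add_measure]

lemma lowerMoment_add : lowerMoment Q (μ + ν) π f p c n =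
    lowerMoment Q μ π f p c n + lowerMoment Q ν π f p c n := by
  simp only [lowerMoment, chainLaw_add, lintegral_add_measure]

lemma chainLaw_apply_univ : chainLaw Q μ Set.univ = μ Set.univ := by
  conv_rhs => rw [← map_chainLaw_zero Q μ, Measure.map_apply (by fun_prop) .univ]
  rfl

variable {f π p c l n k μ ν}

lemma couplingCost_nonneg (hp : 0 ≤ p) : 0 ≤ couplingCost p c k := by
  unfold couplingCost
  positivity

lemma le_couplingCost (hp : 1 ≤ p) (hk : 0 < k) (hc : 0 ≤ c) :
    (2 * (c + 2 * k)) ^ p + couplingCost p (c + 2 * k) k / 4 ≤ couplingCost p c k := by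
  have : (0 : ℝ) < k := by exact_mod_cast hk
  have hp₀ : 0 < p := by linarith
  have h_exp : Real.exp ((c + 2 * k) / (2 * k)) = Real.exp 1 * Real.exp (c / (2 * k)) := by
    rw [← Real.exp_add, add_div, div_self (by positivity), add_comm]
  have h_inv : Real.exp (-1) ^ p * Real.exp 1 ≤ 1 := by
    rw [← Real.exp_mul, ← Real.exp_add, Real.exp_le_one_iff]
    linarith
  have h_pow : (2 * (c + 2 * k)) ^ p ≤ (4 * k * p) ^ p * Real.exp (c / (2 * k)) := calc
    (2 * (c + 2 * k)) ^ p
    _ ≤ (p / (4 * k : ℝ)⁻¹ * Real.exp (-1)) ^ p *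
          Real.exp ((4 * k : ℝ)⁻¹ * (2 * (c + 2 * k))) :=
        rpow_le_mul_exp hp₀ (by positivity) (by positivity)
    _ = (4 * k * p) ^ p * (Real.exp (-1) ^ p * Real.exp 1) * Real.exp (c / (2 * k)) := by
        have h_arg : (4 * k : ℝ)⁻¹ * (2 * (c + 2 * k)) = (c + 2 * k) / (2 * k) := by
          field_simp
          ring
        rw [h_arg, h_exp, div_inv_eq_mul, mul_comm p, Real.mul_rpow (by positivity) (by positivity)]
        ring
    _ ≤ (4 * k * p) ^ p * 1 * Real.exp (c / (2 * k)) := by gcongr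
    _ = (4 * k * p) ^ p * Real.exp (c / (2 * k)) := by rw [mul_one]
  rw [couplingCost, couplingCost, h_exp]
  have h_three : Real.exp 1 ≤ 3 := by linarith [Real.exp_one_lt_d9]
  have h_nonneg : 0 ≤ (4 * k * p) ^ p * Real.exp (c / (2 * k)) := by positivity
  nlinarith [mul_le_mul_of_nonneg_left h_three h_nonneg]

lemma ofReal_mul_add_couplingCost (hp : 0 ≤ p) {w x : ℝ} (hw : 0 ≤ w) (hx : 0 ≤ x) :
    ENNReal.ofReal (w * (x + couplingCost p c k / 4)) =
      ENNReal.ofReal (w * x) + ENNReal.ofReal (w * couplingCost p c k) * (1 / 4) := by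
  have h_cost : 0 ≤ couplingCost p c k := couplingCost_nonneg hp
  rw [mul_add, ENNReal.ofReal_add (by positivity) (by positivity), ← mul_div_assoc,
    ENNReal.ofReal_div_of_pos (by norm_num), ENNReal.ofReal_ofNat, div_eq_mul_inv _ (4 : ENNReal),
    one_div]

lemma rpow_le_couplingCost (hp : 1 ≤ p) (hk : 0 < k) (hc : 0 ≤ c) :
    (2 * k + c) ^ p ≤ couplingCost p c k := by
  have hp₀ : 0 < p := by linarith
  have h_nonneg : 0 ≤ couplingCost p (c + 2 * k) k := couplingCost_nonneg hp₀.le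
  have h_le : (2 * k + c) ^ p ≤ (2 * (c + 2 * k)) ^ p := by
    gcongr
    linarith [k.cast_nonneg (α := ℝ)]
  linarith [le_couplingCost hp hk hc]

lemma upperMoment_le_lowerMoment (hp : 1 ≤ p) (hc : 0 ≤ c) (hl : 0 < l) (hl₁ : l < 1) :
    upperMoment Q μ π f p c n ≤ ENNReal.ofReal (l ^ (1 - p)) * lowerMoment Q μ π f p c n
      + ENNReal.ofReal ((1 - l) ^ (1 - p) * (2 * c) ^ p) * μ Set.univ := by
  have : 0 < 1 - l := sub_pos.2 hl₁
  rw [lowerMoment, ← lintegral_const_mul' _ _ ENNReal.ofReal_ne_top, ← chainLaw_apply_univ Q μ,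
    ← lintegral_const, ← lintegral_add_right _ measurable_const]
  refine lintegral_mono fun ω => ?_
  set x := |centeredSum π f n ω|
  rw [← ENNReal.ofReal_mul (by positivity), ← ENNReal.ofReal_add (by positivity) (by positivity)]
  refine ENNReal.ofReal_le_ofReal ?_
  calc (x + c) ^ p ≤ (max (x - c) 0 + 2 * c) ^ p := by
        gcongr ?_ ^ p
        linarith [le_max_left (x - c) 0]
    _ ≤ l ^ (1 - p) * max (x - c) 0 ^ p + (1 - l) ^ (1 - p) * (2 * c) ^ p :=
        add_rpow_le_weighted hp hl hl₁ (le_max_right _ _) (by positivity)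

lemma ofReal_integral_eq_upperMoment_zero [IsFiniteMeasure μ] (hf : BoundedMeasurable mZ f)
    (hp : 0 ≤ p) :
    ENNReal.ofReal (∫ ω, |centeredSum π f n ω| ^ p ∂(chainLaw Q μ)) =
      upperMoment Q μ π f p 0 n := by
  rw [ofReal_integral_eq_lintegral_ofReal (((hf.centeredSum n).abs_rpow hp).integrable _)
    (Filter.Eventually.of_forall fun ω => by positivity)]
  simp only [upperMoment, add_zero]

lemma lowerMoment_zero : lowerMoment Q μ π f p 0 n = upperMoment Q μ π f p 0 n := by
  simp only [lowerMoment, upperMoment, sub_zero, add_zero, max_eq_left, abs_nonneg]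

variable [IsProbabilityMeasure π]

lemma upperMoment_le_mul (hf₁ : ∀ z, |f z| ≤ 1) (hp : 1 ≤ p) (hc : 0 ≤ c) :
    upperMoment Q μ π f p c n ≤ ENNReal.ofReal ((2 * n + c) ^ p) * μ Set.univ := by
  rw [← chainLaw_apply_univ Q μ, ← lintegral_const]
  refine lintegral_mono fun ω => ?_
  gcongr
  exact abs_centeredSum_le hf₁ n ω

lemma upperMoment_le_couplingCost (hf₁ : ∀ z, |f z| ≤ 1) (hp : 1 ≤ p) (hl : 0 < l) (hl₁ : l < 1)
    (hk : 0 < k) (hc : 0 ≤ c) (hnk : n ≤ k) :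
    upperMoment Q μ π f p c n ≤
      ENNReal.ofReal ((1 - l) ^ (1 - p) * couplingCost p c k) * μ Set.univ := by
  have h_weight : 1 ≤ (1 - l) ^ (1 - p) :=
    Real.one_le_rpow_of_pos_of_le_one_of_nonpos (by linarith) (by linarith) (by linarith)
  have h_cost : (2 * n + c) ^ p ≤ couplingCost p c k :=
    le_trans (by gcongr) (rpow_le_couplingCost hp hk hc)
  refine (upperMoment_le_mul Q hf₁ hp hc).trans ?_
  gcongr
  exact h_cost.trans (le_mul_of_one_le_left (le_trans (by positivity) h_cost) h_weight)

lemma abs_centeredSum_add_sub_le (hf₁ : ∀ z, |f z| ≤ 1) (ω : ℕ → Z) :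
    |(|centeredSum π f (k + n) ω| - |centeredSum π f n (fun i => ω (i + k))|)| ≤ 2 * k := by
  refine (abs_abs_sub_abs_le _ _).trans ?_
  rw [centeredSum_add, add_sub_cancel_right]
  exact abs_centeredSum_le hf₁ k ω

variable [IsFiniteMeasure μ]

lemma upperMoment_le_comp_pow (hf : Measurable f) (hf₁ : ∀ z, |f z| ≤ 1) (hp : 1 ≤ p)
    (hc : 0 ≤ c) : upperMoment Q μ π f p c (k + n) ≤
      upperMoment Q ((Q ^ k : Kernel Z Z) ∘ₘ μ) π f p (c + 2 * k) n := by
  have h_meas := ((BoundedMeasurable.of_abs_le hf hf₁).centeredSum (π := π) n).measurable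
  rw [upperMoment, upperMoment, ← map_shift_chainLaw, lintegral_map (by fun_prop) (by fun_prop)]
  refine lintegral_mono fun ω => ?_
  gcongr ENNReal.ofReal (?_ ^ p)
  linarith [(abs_le.1 (abs_centeredSum_add_sub_le (π := π) (k := k) (n := n) hf₁ ω)).2]

lemma lowerMoment_comp_pow_le (hf : Measurable f) (hf₁ : ∀ z, |f z| ≤ 1) (hp : 1 ≤ p) :
    lowerMoment Q ((Q ^ k : Kernel Z Z) ∘ₘ μ) π f p (c + 2 * k) n ≤
      lowerMoment Q μ π f p c (k + n) := by
  have h_meas := ((BoundedMeasurable.of_abs_le hf hf₁).centeredSum (π := π) n).measurable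
  rw [lowerMoment, lowerMoment, ← map_shift_chainLaw, lintegral_map (by fun_prop) (by fun_prop)]
  refine lintegral_mono fun ω => ?_
  gcongr ENNReal.ofReal (max ?_ 0 ^ p)
  linarith [(abs_le.1 (abs_centeredSum_add_sub_le (π := π) (k := k) (n := n) hf₁ ω)).1]

theorem upperMoment_le_lowerMoment_add_couplingCost [IsFiniteMeasure ν]
    (h_mix : ∀ z z' A, MeasurableSet A → (Q ^ k) z A ≤ (Q ^ k) z' A + 1 / 4) (hk : 0 < k)
    (hf : Measurable f) (hf₁ : ∀ z, |f z| ≤ 1) (hp : 1 ≤ p) (hl : 0 < l) (hl₁ : l < 1)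
    (hc : 0 ≤ c) (h_mass : μ Set.univ = ν Set.univ) :
    upperMoment Q μ π f p c n ≤ ENNReal.ofReal (l ^ (1 - p)) * lowerMoment Q ν π f p c n
      + ENNReal.ofReal ((1 - l) ^ (1 - p) * couplingCost p c k) * μ Set.univ := by
  induction n using Nat.strong_induction_on generalizing c μ ν with
  | _ n ih =>
  rcases le_total n k with hnk | hkn
  · exact (upperMoment_le_couplingCost Q hf₁ hp hl hl₁ hk hc hnk).trans le_add_self
  obtain ⟨m, rfl⟩ := Nat.exists_eq_add_of_le hkn
  set c' := c + 2 * k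
  set L := ENNReal.ofReal (l ^ (1 - p))
  set w := (1 - l) ^ (1 - p)
  have hc' : 0 ≤ c' := by positivity
  have hw : 0 ≤ w := Real.rpow_nonneg (sub_nonneg.2 hl₁.le) _
  have h_mass' : ((Q ^ k : Kernel Z Z) ∘ₘ μ) Set.univ = ((Q ^ k : Kernel Z Z) ∘ₘ ν) Set.univ := by
    rw [Measure.comp_apply_univ, Measure.comp_apply_univ, h_mass]
  obtain ⟨α, η, η', _, hη, hη', hμ_eq, hν_eq, hη_mass, hη_le⟩ := exists_eq_add_eq_add h_mass'
    fun A hA => comp_apply_le_comp_apply_add h_mix h_mass hA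
  have hα_le : α Set.univ ≤ μ Set.univ := by
    rw [← Measure.comp_apply_univ (μ := μ) (κ := Q ^ k), hμ_eq, Measure.add_apply]
    exact le_self_add
  have h_common := upperMoment_le_lowerMoment Q (μ := α) (f := f) (π := π) (n := m) hp hc' hl hl₁
  have h_rest := ih m (by omega) hc' hη_mass
  calc upperMoment Q μ π f p c (k + m) ≤ upperMoment Q (α + η) π f p c' m := by
        rw [← hμ_eq]
        exact upperMoment_le_comp_pow Q hf hf₁ hp hc
    _ ≤ (L * lowerMoment Q α π f p c' m + ENNReal.ofReal (w * (2 * c') ^ p) * μ Set.univ) +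
          (L * lowerMoment Q η' π f p c' m +
            ENNReal.ofReal (w * couplingCost p c' k) * (1 / 4 * μ Set.univ)) := by
        rw [upperMoment_add]
        refine add_le_add (h_common.trans ?_) (h_rest.trans ?_) <;> gcongr
    _ = L * lowerMoment Q (α + η') π f p c' m +
          ENNReal.ofReal (w * ((2 * c') ^ p + couplingCost p c' k / 4)) * μ Set.univ := by
        rw [lowerMoment_add, ofReal_mul_add_couplingCost (by linarith) hw (by positivity)]
        ring
    _ ≤ L * lowerMoment Q ν π f p c (k + m) +
          ENNReal.ofReal (w * couplingCost p c k) * μ Set.univ := by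
        rw [← hν_eq]
        gcongr
        · exact lowerMoment_comp_pow_le Q hf hf₁ hp
        · exact le_couplingCost hp hk hc

theorem momentNorm_le_momentNorm_add (ξ ξ' : Measure Z) [IsProbabilityMeasure ξ]
    [IsProbabilityMeasure ξ']
    (h_mix : ∀ z z' A, MeasurableSet A → (Q ^ k) z A ≤ (Q ^ k) z' A + 1 / 4) (hk : 0 < k)
    (hf : Measurable f) (hf₁ : ∀ z, |f z| ≤ 1) (hp : 1 ≤ p) :
    momentNorm Q ξ π f n p ≤ momentNorm Q ξ' π f n p + 16 * k * p := by
  have hp₀ : 0 ≤ p := by linarith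
  have hf_bdd : BoundedMeasurable mZ f := .of_abs_le hf hf₁
  have h_nonneg : ∀ m, 0 ≤ ∫ ω, |centeredSum π f n ω| ^ p ∂(chainLaw Q m) := fun m =>
    integral_nonneg fun ω => by positivity
  have h_cost : couplingCost p 0 k ≤ (16 * k * p) ^ p := calc
    couplingCost p 0 k = 4 ^ (1 : ℝ) * (4 * k * p) ^ p := by simp [couplingCost]
    _ ≤ 4 ^ p * (4 * k * p) ^ p := by
        gcongr
        norm_num
    _ = (16 * k * p) ^ p := by
        rw [← Real.mul_rpow (by norm_num) (by positivity)]
        ring_nf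
  refine rpow_one_div_le_add hp (h_nonneg ξ) (h_nonneg ξ') (by positivity) fun l hl hl₁ => ?_
  have : 0 < 1 - l := sub_pos.2 hl₁
  have h_main : 0 ≤ l ^ (1 - p) * ∫ ω, |centeredSum π f n ω| ^ p ∂(chainLaw Q ξ') :=
    mul_nonneg (by positivity) (h_nonneg ξ')
  have h_rest : 0 ≤ (1 - l) ^ (1 - p) * couplingCost p 0 k :=
    mul_nonneg (by positivity) (couplingCost_nonneg hp₀)
  have h := upperMoment_le_lowerMoment_add_couplingCost Q (μ := ξ) (ν := ξ') (π := π) (n := n)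
    h_mix hk hf hf₁ hp hl hl₁ le_rfl (by rw [measure_univ, measure_univ])
  rw [lowerMoment_zero, ← ofReal_integral_eq_upperMoment_zero Q hf_bdd hp₀,
    ← ofReal_integral_eq_upperMoment_zero Q hf_bdd hp₀, measure_univ, mul_one,
    ← ENNReal.ofReal_mul (by positivity), ← ENNReal.ofReal_add h_main h_rest,
    ENNReal.ofReal_le_ofReal_iff (add_nonneg h_main h_rest)] at h
  exact h.trans (by gcongr)

end MomentComparison

end MarkovRosenthal

theorem theorem1_general {Z : Type*} [MeasurableSpace Z]
    (Q : Kernel Z Z) [IsMarkovKernel Q] (π : Measure Z) [IsProbabilityMeasure π] (τ : ℕ)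
    (hQ : MarkovRosenthal.IsUniformlyGeometricallyErgodic Q π τ)
    (f : Z → ℝ) (hf : Measurable f) (hf_bound : ∀ z, |f z| ≤ 1)
    (p : ℝ) (hp : 1 ≤ p) (n : ℕ) :
    (Summable (fun l : ℕ => MarkovRosenthal.autocov Q π f (l + 1)) ∧
      0 ≤ MarkovRosenthal.asymptoticVariance Q π f) ∧
    (∀ (ξ : Measure Z) [IsProbabilityMeasure ξ],
      MarkovRosenthal.momentNorm Q ξ π f n p ≤
        MarkovRosenthal.CRm1 * Real.sqrt 2 * p ^ (1 / 2 : ℝ) * (n : ℝ) ^ (1 / 2 : ℝ) *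
            MarkovRosenthal.asymptoticStd Q π f
          + MarkovRosenthal.D1 * (n : ℝ) ^ (1 / 4 : ℝ) * (τ : ℝ) ^ (3 / 4 : ℝ) * p *
            Real.logb 2 (2 * p)
          + MarkovRosenthal.D2 * τ * p * Real.logb 2 (2 * p)) ∧
    ∀ (ξ ξ' : Measure Z) [IsProbabilityMeasure ξ] [IsProbabilityMeasure ξ'],
      MarkovRosenthal.momentNorm Q ξ π f n p ≤
        MarkovRosenthal.momentNorm Q ξ' π f n p
          + 2 * MarkovRosenthal.D2 * τ * p * Real.logb 2 (2 * p) := by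
  refine ⟨⟨(summable_nat_add_iff 1).2 (hQ.summable_autocov hf hf_bound),
    hQ.asymptoticVariance_nonneg hf hf_bound⟩,
    fun ξ _ => hQ.momentNorm_le_rosenthal ξ hf hf_bound hp n, fun ξ ξ' _ _ => ?_⟩
  have hτ : 0 < 2 * τ := mul_pos two_pos hQ.mixingTime_pos
  have h_log := MarkovRosenthal.one_le_logb_two_mul hp
  calc MarkovRosenthal.momentNorm Q ξ π f n p
    _ ≤ MarkovRosenthal.momentNorm Q ξ' π f n p + 16 * (2 * τ : ℕ) * p :=
        MarkovRosenthal.momentNorm_le_momentNorm_add Q ξ ξ' hQ.pow_apply_le hτ hf hf_bound hp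
    _ = MarkovRosenthal.momentNorm Q ξ' π f n p + 32 * τ * p * 1 := by
        push_cast
        ring
    _ ≤ _ := by
        have h_D2 : 32 ≤ 2 * MarkovRosenthal.D2 := by linarith [MarkovRosenthal.le_D2]
        gcongr

theorem theorem1 {Z : Type*} [MetricSpace Z] [CompleteSpace Z]
    [TopologicalSpace.SeparableSpace Z] [MeasurableSpace Z] [BorelSpace Z]
    (Q : Kernel Z Z) [IsMarkovKernel Q] (π : Measure Z) [IsProbabilityMeasure π] (τ : ℕ)
    (hQ : MarkovRosenthal.IsUniformlyGeometricallyErgodic Q π τ)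
    (f : Z → ℝ) (hf : Measurable f) (hf_bound : ∀ z, |f z| ≤ 1)
    (p : ℝ) (hp : 2 ≤ p) (n : ℕ) :
    -- the asymptotic variance is well defined: its series converges and it is nonnegative
    (Summable (fun l : ℕ => MarkovRosenthal.autocov Q π f (l + 1)) ∧
      0 ≤ MarkovRosenthal.asymptoticVariance Q π f) ∧
    -- the stationary bound
    MarkovRosenthal.momentNorm Q π π f n p ≤
      MarkovRosenthal.CRm1 * Real.sqrt 2 * p ^ (1 / 2 : ℝ) * (n : ℝ) ^ (1 / 2 : ℝ) *
          MarkovRosenthal.asymptoticStd Q π f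
        + MarkovRosenthal.D1 * (n : ℝ) ^ (1 / 4 : ℝ) * (τ : ℝ) ^ (3 / 4 : ℝ) * p *
          Real.logb 2 (2 * p)
        + MarkovRosenthal.D2 * τ * p * Real.logb 2 (2 * p) ∧
    -- the bound for an arbitrary initial distribution
    ∀ (ξ : Measure Z) [IsProbabilityMeasure ξ],
      MarkovRosenthal.momentNorm Q ξ π f n p ≤
        MarkovRosenthal.momentNorm Q π π f n p
          + 2 * MarkovRosenthal.D2 * τ * p * Real.logb 2 (2 * p) := by
  obtain ⟨h_variance, h_rosenthal, h_law⟩ :=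
    theorem1_general Q π τ hQ f hf hf_bound p (one_le_two.trans hp) n
  exact ⟨h_variance, h_rosenthal π, fun ξ _ => h_law ξ π⟩
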